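/- Let $H^1=H^1(\mathbb R)$ be the Sobolev space of real-valued functions on $\mathbb R$ with norm $\|f\|_{H^1}=(\|f\|_{L^2}^2+\|f_x\|_{L^2}^2)^{1/2}$, and let $$(Hf)(x)=\frac1\pi\,\mathrm{P.V.}\!\int_{-\infty}^{\infty}\frac{f(y)}{x-y}\,dy$$ be the Hilbert transform. For $u_0,v_0\in H^1$ and $0<T<\infty$, a solution on $[0,T)$ of the system $$u_t=2uv,\qquad v_t=H(u^2),\qquad u(0)=u_0,\quad v(0)=v_0 \qquad (x\in\mathbb R)$$ means a pair $u,v\in C^1([0,T);H^1)$ with these initial values which satisfies, for every $t\in[0,T)$, both equations for almost every $x\in\mathbb R$. **Theorem.** Let $u_0,v_0\in H^1$, and suppose that $u_0$ is supported in the interval $(a,b)$ (that is, $u_0=0$ almost everywhere outside $(a,b)$). Put $\phi(x)=x-a$ and $$C=4\int_a^b\phi(x)\,u_0(x)^2\,v_0(x)\,dx,\qquad I_\infty=\int_0^\infty\frac{dy}{\sqrt{y^3+1}},\qquad T^*=\left(\frac{4C}{3\pi(b-a)^2}\right)^{-1/3}I_\infty .$$ If $C>0$, then the solution of the system with initial values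 $u_0,v_0$ develops a singularity in the $H^1$ norm no later than $T^*$. Precisely, there are a time $T$ with $0<T\le T^*$ and a solution $(u,v)$ on $[0,T)$ such that $$\lim_{t\to T^-}\big(\|u(t)\|_{H^1}+\|v(t)\|_{H^1}\big)=+\infty ,$$ and $(u,v)$ is the unique maximal solution: every solution $(u',v')$ on an interval $[0,T')$ with the same initial values satisfies $T'\le T$ and $(u',v')=(u,v)$ on $[0,T')$. -/

import Mathlib

open MeasureTheory Filter Set Topology
open scoped ContDiff

/-- `g` is the weak derivative of `f` on `ℝ`, for `f, g ∈ L²(ℝ)`: `∫ f φ' = - ∫ g φ` for every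
`φ ∈ C_c^∞(ℝ)`. -/
def HasWeakDeriv (f g : Lp ℝ 2 (volume : Measure ℝ)) : Prop :=
  ∀ φ : ℝ → ℝ, ContDiff ℝ ∞ φ → HasCompactSupport φ →
    ∫ x, f x * deriv φ x = - ∫ x, g x * φ x

/-- An `L²` function times a continuous compactly supported function is integrable. -/
theorem integrable_lp_mul_test (f : Lp ℝ 2 (volume : Measure ℝ)) {φ : ℝ → ℝ}
    (hφ : Continuous φ) (hc : HasCompactSupport φ) :
    Integrable (fun x => f x * φ x) :=
  (Lp.memLp f).integrable_mul (hφ.memLp_of_hasCompactSupport (p := 2) hc)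

/-- The Sobolev space `H¹(ℝ)` of real-valued functions, realised as the subspace
`{(f, f') : f ∈ L², f' ∈ L²}` of the Hilbert sum `L²(ℝ) ⊕ L²(ℝ)`, where `f'` is the weak derivative
of `f` (which is determined by `f`). -/
def h1Submodule :
    Submodule ℝ (WithLp 2 (Lp ℝ 2 (volume : Measure ℝ) × Lp ℝ 2 (volume : Measure ℝ))) where
  carrier := {p | HasWeakDeriv p.fst p.snd}
  zero_mem' := by
    intro φ _ _
    have h : ((0 : Lp ℝ 2 (volume : Measure ℝ)) : ℝ → ℝ) =ᵐ[volume] 0 := Lp.coeFn_zero ℝ 2 volume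
    have e : ∀ ψ : ℝ → ℝ, ∫ x, (0 : Lp ℝ 2 (volume : Measure ℝ)) x * ψ x = 0 := fun ψ =>
      integral_eq_zero_of_ae (by filter_upwards [h] with x hx; rw [hx]; simp)
    change ∫ x, (0 : Lp ℝ 2 (volume : Measure ℝ)) x * deriv φ x
      = - ∫ x, (0 : Lp ℝ 2 (volume : Measure ℝ)) x * φ x
    rw [e, e, neg_zero]
  add_mem' := by
    intro p q hp hq φ hφ hc
    have hφ' : Continuous (deriv φ) := hφ.continuous_deriv (by simp)
    have e1 : ∫ x, (p.fst + q.fst) x * deriv φ x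
        = (∫ x, p.fst x * deriv φ x) + ∫ x, q.fst x * deriv φ x := by
      rw [← integral_add (integrable_lp_mul_test _ hφ' hc.deriv)
        (integrable_lp_mul_test _ hφ' hc.deriv)]
      refine integral_congr_ae ?_
      filter_upwards [Lp.coeFn_add p.fst q.fst] with x hx
      rw [hx, Pi.add_apply, add_mul]
    have e2 : ∫ x, (p.snd + q.snd) x * φ x = (∫ x, p.snd x * φ x) + ∫ x, q.snd x * φ x := by
      rw [← integral_add (integrable_lp_mul_test _ hφ.continuous hc)
        (integrable_lp_mul_test _ hφ.continuous hc)]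
      refine integral_congr_ae ?_
      filter_upwards [Lp.coeFn_add p.snd q.snd] with x hx
      rw [hx, Pi.add_apply, add_mul]
    have hp' := hp φ hφ hc
    have hq' := hq φ hφ hc
    change ∫ x, (p.fst + q.fst) x * deriv φ x = - ∫ x, (p.snd + q.snd) x * φ x
    rw [e1, e2, hp', hq', neg_add]
  smul_mem' := by
    intro c p hp φ hφ hc
    have e1 : ∫ x, (c • p.fst) x * deriv φ x = c * ∫ x, p.fst x * deriv φ x := by
      rw [← integral_const_mul]
      refine integral_congr_ae ?_
      filter_upwards [Lp.coeFn_smul c p.fst] with x hx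
      simp [hx, mul_assoc]
    have e2 : ∫ x, (c • p.snd) x * φ x = c * ∫ x, p.snd x * φ x := by
      rw [← integral_const_mul]
      refine integral_congr_ae ?_
      filter_upwards [Lp.coeFn_smul c p.snd] with x hx
      simp [hx, mul_assoc]
    have hp' := hp φ hφ hc
    change ∫ x, (c • p.fst) x * deriv φ x = - ∫ x, (c • p.snd) x * φ x
    rw [e1, e2, hp', mul_neg]

/-- The Sobolev space `H¹(ℝ)`, with the norm `‖f‖ = (‖f‖²_{L²} + ‖f'‖²_{L²})^{1/2}`. -/
abbrev H1 : Type := ↥h1Submodule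

/-- The function underlying an element of `H¹(ℝ)` (well defined up to almost everywhere equality). -/
noncomputable def H1.fn (f : H1) : ℝ → ℝ := fun x => f.val.fst x

/-- The principal value defining the Hilbert transform of `f` at `x` exists and
`(H f)(x) = (1/π) P.V. ∫ f(y) / (x - y) dy = l`. -/
def HasHilbertTransformAt (f : ℝ → ℝ) (x l : ℝ) : Prop :=
  Tendsto (fun ε : ℝ => (1 / Real.pi) * ∫ y in {y : ℝ | ε < |x - y|}, f y / (x - y))
    (𝓝[>] 0) (𝓝 l)

/-- `(u, v)` is a solution in `C¹([0, T); H¹(ℝ))` of `u_t = 2 u v`, `v_t = H(u²)` with initial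
values `u₀, v₀`. The time derivatives are taken in `H¹(ℝ)` (one-sided at `t = 0`). -/
structure IsH1Solution (u₀ v₀ : H1) (T : ℝ) (u v : ℝ → H1) : Prop where
  pos : 0 < T
  initial_u : u 0 = u₀
  initial_v : v 0 = v₀
  contDiffOn_u : ContDiffOn ℝ 1 u (Ico 0 T)
  contDiffOn_v : ContDiffOn ℝ 1 v (Ico 0 T)
  eq_u : ∀ t ∈ Ico 0 T, ∀ᵐ x : ℝ,
    (derivWithin u (Ico 0 T) t).fn x = 2 * (u t).fn x * (v t).fn x
  eq_v : ∀ t ∈ Ico 0 T, ∀ᵐ x : ℝ,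
    HasHilbertTransformAt (fun y => (u t).fn y ^ 2) x ((derivWithin v (Ico 0 T) t).fn x)

/-! The system is an ODE `w' = N(w)` in the Hilbert space `H1 × H1` with `N(u, v) = (2uv, H(u²))`.
Both components of `N` are bounded and bilinear, so `N` is Lipschitz on balls. Picard–Lindelöf gives
a local existence time depending only on the size of the data, and hence the alternative behind
`LipschitzOnBalls.exists_maximal`: if lifespans are bounded, the maximal solution exists, is unique,
and its norm tends to infinity.

The bound for lifespans comes from the moment `F(t) = ∫_a^b (x - a) u² dx`. Since `u_t = 2uv` is a
linear ODE in `t` for each fixed `x`, zeros of `u₀` persist and `u(t)` stays supported in `(a, b)`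
(`IsForwardSolution.rep_eq_zero`). Then `F' = 4 ∫ (x - a) u² v`, with `F'(0) = C`, and `F'' = 4 ∫ (x
- a) u² H(u²) + 16 ∫ (x - a) u² v²`. The last term is nonnegative. The first is computed exactly by
`IsW1Pair.integral_mul_hilb`: `∫ (x - a) f H f = (∫ f)² / 2π`. Because `F ≤ (b - a) ∫ u²`, this
gives `F'' ≥ 2 F² / (π (b - a)²)`, and `lifespan_le_of_deriv_deriv_ge` integrates the inequality to
the bound `T*`.

The analytic work is to make `H` act on products in `H¹`. It is approximated by convolution with the
conjugate Poisson kernel, whose autocorrelation is a positive Poisson kernel; this yields an `L²`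
bound uniform in `ε` (`integral_conjPoisson_sq_le`). Convolution commutes with differentiation, so
the bound holds in `H¹`, and weak compactness passes it to the limit
(`IsW1Pair.exists_rep_eq_hilb`). -/

/-! ### Primitives and integration by parts. -/

theorem MeasureTheory.LocallyIntegrable.intervalIntegrable {f : ℝ → ℝ} (hf : LocallyIntegrable f)
    {a b : ℝ} : IntervalIntegrable f volume a b :=
  (hf.integrableOn_isCompact isCompact_uIcc).intervalIntegrable

theorem HasCompactSupport.exists_forall_abs_ge {φ : ℝ → ℝ} (hc : HasCompactSupport φ) :
    ∃ R : ℝ, 0 < R ∧ tsupport φ ⊆ Ioc (-R) R := by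
  obtain ⟨R, hR⟩ := hc.isCompact.isBounded.subset_ball 0
  refine ⟨max R 1, by positivity, hR.trans ?_⟩
  rw [Real.ball_eq_Ioo]
  intro x hx
  constructor
  · have := hx.1; have := le_max_left R 1; linarith
  · have := hx.2; have := le_max_left R 1; linarith

/-- `F` is a primitive of `g`. -/
def IsPrimitive (F g : ℝ → ℝ) : Prop := ∀ x y, F y - F x = ∫ t in x..y, g t

namespace IsPrimitive

variable {F g : ℝ → ℝ}

theorem absolutelyContinuous (h : IsPrimitive F g) (hg : LocallyIntegrable g) (a b : ℝ) :
    AbsolutelyContinuousOnInterval F a b := by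
  have h1 := (IntervalIntegrable.absolutelyContinuousOnInterval_intervalIntegral (c := a)
    (hg.intervalIntegrable (a := a) (b := b)) (by simp))
  have h2 : AbsolutelyContinuousOnInterval (fun _ : ℝ => F a) a b :=
    contDiffOn_const.absolutelyContinuousOnInterval
  have h3 := h2.add h1
  convert! h3 using 1
  funext x
  have := h a x
  simp only [Pi.add_apply]
  linarith

theorem continuous (h : IsPrimitive F g) (hg : LocallyIntegrable g) : Continuous F := by
  have : F = fun x => F 0 + ∫ t in (0 : ℝ)..x, g t := by
    funext x; have := h 0 x; linarith
  rw [this]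
  exact continuous_const.add
    (intervalIntegral.continuous_primitive (fun a b => hg.intervalIntegrable) 0)

theorem ae_hasDerivAt (h : IsPrimitive F g) (hg : LocallyIntegrable g) :
    ∀ᵐ x, HasDerivAt F (g x) x := by
  filter_upwards [LocallyIntegrable.ae_hasDerivAt_integral hg] with x hx
  have : F = fun x => F 0 + ∫ t in (0 : ℝ)..x, g t := by
    funext x; have := h 0 x; linarith
  rw [this]
  exact (hx 0).const_add _

theorem mul {G k : ℝ → ℝ} (hF : IsPrimitive F g) (hg : LocallyIntegrable g)
    (hG : IsPrimitive G k) (hk : LocallyIntegrable k) :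
    IsPrimitive (fun x => F x * G x) (fun x => g x * G x + F x * k x) := by
  intro x y
  rw [← (hF.absolutelyContinuous hg x y).integral_deriv_mul_eq_sub
    (hG.absolutelyContinuous hk x y)]
  apply intervalIntegral.integral_congr_ae
  filter_upwards [hF.ae_hasDerivAt hg, hG.ae_hasDerivAt hk] with t h1 h2 _
  rw [h1.deriv, h2.deriv]

theorem integral_mul_deriv_test (h : IsPrimitive F g) (hg : LocallyIntegrable g) {φ : ℝ → ℝ}
    (hφ : ContDiff ℝ ∞ φ) (hc : HasCompactSupport φ) :
    ∫ x, F x * deriv φ x = - ∫ x, g x * φ x := by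
  obtain ⟨R, hR, hs⟩ := hc.exists_forall_abs_ge
  have h0 : ∀ x, x ∉ Ioc (-R) R → φ x = 0 := fun x hx => image_eq_zero_of_notMem_tsupport
    (fun h' => hx (hs h'))
  have e1 : ∫ x, F x * deriv φ x = ∫ x in (-R)..R, F x * deriv φ x := by
    rw [intervalIntegral.integral_eq_integral_of_support_subset]
    intro x hx
    refine hs (support_deriv_subset (f := φ) (𝕜 := ℝ) ?_)
    exact right_ne_zero_of_mul hx
  have e2 : ∫ x, g x * φ x = ∫ x in (-R)..R, deriv F x * φ x := by
    rw [← intervalIntegral.integral_eq_integral_of_support_subset (a := -R) (b := R)]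
    · apply intervalIntegral.integral_congr_ae
      filter_upwards [h.ae_hasDerivAt hg] with x hx _
      rw [hx.deriv]
    · intro x hx
      exact hs (subset_tsupport _ (right_ne_zero_of_mul hx))
  have hac : AbsolutelyContinuousOnInterval φ (-R) R :=
    (hφ.of_le (by simp)).contDiffOn.absolutelyContinuousOnInterval
  have b1 : φ (-R) = 0 := h0 _ (by simp)
  -- `R` itself belongs to `Ioc (-R) R`, so vanishing there comes by continuity from the right.
  have b2 : φ R = 0 := by
    have hcl : IsClosed {x | φ x = 0} := isClosed_eq hφ.continuous continuous_const
    have : Ici R ⊆ {x | φ x = 0} := by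
      rw [← closure_Ioi]
      exact hcl.closure_subset_iff.2 (fun x hx => h0 x (fun h' => not_lt.2 h'.2 hx))
    exact this self_mem_Ici
  rw [e1, e2, (h.absolutelyContinuous hg _ _).integral_mul_deriv_eq_deriv_mul hac, b1, b2]
  ring

end IsPrimitive

/-! ### Weak derivatives and continuous representatives. -/

theorem integrable_mul_test {w φ : ℝ → ℝ} (hw : LocallyIntegrable w) (hφ : Continuous φ)
    (hc : HasCompactSupport φ) : Integrable (fun x => w x * φ x) := by
  simpa [mul_comm] using hw.integrable_smul_left_of_hasCompactSupport hφ hc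

/-- A smooth compactly supported function of mean zero is the derivative of such a function. -/
theorem exists_deriv_eq_of_integral_eq_zero {ψ : ℝ → ℝ} (hψ : ContDiff ℝ ∞ ψ)
    (hc : HasCompactSupport ψ) (h0 : ∫ x, ψ x = 0) :
    ∃ φ : ℝ → ℝ, ContDiff ℝ ∞ φ ∧ HasCompactSupport φ ∧ deriv φ = ψ := by
  obtain ⟨R, hR, hs⟩ := hc.exists_forall_abs_ge
  have hz : ∀ x, x ∉ Ioc (-R) R → ψ x = 0 := fun x hx => image_eq_zero_of_notMem_tsupport
    (fun h' => hx (hs h'))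
  have hd : ∀ x, HasDerivAt (fun x => ∫ t in (-R)..x, ψ t) (ψ x) x := fun x =>
    intervalIntegral.integral_hasDerivAt_right (hψ.continuous.intervalIntegrable _ _)
      (hψ.continuous.stronglyMeasurableAtFilter _ _) hψ.continuous.continuousAt
  have hder : deriv (fun x => ∫ t in (-R)..x, ψ t) = ψ := funext fun x => (hd x).deriv
  refine ⟨fun x => ∫ t in (-R)..x, ψ t, ?_, ?_, hder⟩
  · rw [contDiff_infty_iff_deriv]
    exact ⟨fun x => (hd x).differentiableAt, by rw [hder]; exact hψ⟩
  · refine HasCompactSupport.of_support_subset_isCompact (isCompact_Icc (a := -R) (b := R)) ?_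
    intro x hx
    by_contra hx'
    apply hx
    rw [mem_Icc, not_and_or, not_le, not_le] at hx'
    rcases hx' with h | h
    · refine intervalIntegral.integral_zero_ae (Eventually.of_forall fun t ht => hz t ?_)
      rw [uIoc_of_ge h.le] at ht
      exact fun h' => not_lt.2 ht.2 h'.1
    · change ∫ t in (-R)..x, ψ t = 0
      rw [intervalIntegral.integral_eq_integral_of_support_subset, h0]
      exact (subset_tsupport _).trans (hs.trans (Ioc_subset_Ioc_right h.le))

/-- The lemma of du Bois-Reymond. -/
theorem ae_eq_const_of_integral_mul_deriv_eq_zero {w : ℝ → ℝ} (hw : LocallyIntegrable w)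
    (h : ∀ φ : ℝ → ℝ, ContDiff ℝ ∞ φ → HasCompactSupport φ → ∫ x, w x * deriv φ x = 0) :
    ∃ c : ℝ, ∀ᵐ x, w x = c := by
  let η : ContDiffBump (0 : ℝ) := ⟨1, 2, one_pos, one_lt_two⟩
  have hη : ContDiff ℝ ∞ (η.normed volume) := η.contDiff_normed
  have hηc : HasCompactSupport (η.normed volume) := η.hasCompactSupport_normed
  -- The bump has integral one, so the constant must be the pairing of `w` with it. Any test
  -- function minus its integral times the bump has mean zero, hence is a derivative.
  refine ⟨∫ x, w x * η.normed volume x, ?_⟩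
  refine ae_eq_of_integral_contDiff_smul_eq hw (locallyIntegrable_const _) fun ψ hψ hψc => ?_
  have hi : Integrable ψ := hψ.continuous.integrable_of_hasCompactSupport hψc
  have hηi : Integrable (η.normed volume) := hη.continuous.integrable_of_hasCompactSupport hηc
  set c : ℝ := ∫ x, ψ x with hcdef
  obtain ⟨φ, h1, h2, h3⟩ := exists_deriv_eq_of_integral_eq_zero
    (ψ := fun x => ψ x - c * η.normed volume x) (hψ.sub (contDiff_const.mul hη))
    (hψc.sub hηc.mul_left) (by
      rw [integral_sub hi (hηi.const_mul c), integral_const_mul, η.integral_normed, mul_one,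
        sub_self])
  have h4 := h φ h1 h2
  simp only [h3, mul_sub] at h4
  have hcη : Integrable fun x => w x * (c * η.normed volume x) :=
    integrable_mul_test hw (continuous_const.mul hη.continuous) hηc.mul_left
  rw [integral_sub (integrable_mul_test hw hψ.continuous hψc) hcη] at h4
  have e : ∫ x, w x * (c * η.normed volume x) = c * ∫ x, w x * η.normed volume x := by
    rw [← integral_const_mul]
    congr 1; funext x; ring
  rw [e] at h4
  simp only [smul_eq_mul]
  rw [integral_mul_const, ← hcdef]
  simp only [mul_comm (ψ _)]
  linarith

/-- Every element of `H¹(ℝ)` is represented by a primitive of its weak derivative. -/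
theorem H1.exists_isPrimitive (p : H1) :
    ∃ F : ℝ → ℝ, F =ᵐ[volume] p.val.fst ∧ IsPrimitive F p.val.snd := by
  have hg : LocallyIntegrable p.val.snd := (Lp.memLp p.val.snd).locallyIntegrable (by norm_num)
  have hf : LocallyIntegrable p.val.fst := (Lp.memLp p.val.fst).locallyIntegrable (by norm_num)
  set G : ℝ → ℝ := fun x => ∫ t in (0 : ℝ)..x, p.val.snd t with hGdef
  have hG : IsPrimitive G p.val.snd := fun x y => by
    simp only [hGdef]
    rw [intervalIntegral.integral_interval_sub_left] <;> exact hg.intervalIntegrable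
  have hGc := hG.continuous hg
  obtain ⟨c, hc⟩ := ae_eq_const_of_integral_mul_deriv_eq_zero
    (w := fun x => p.val.fst x - G x) (hf.sub hGc.locallyIntegrable) fun φ hφ hφc => by
      have hφ' : Continuous (deriv φ) := hφ.continuous_deriv (by simp)
      simp only [sub_mul]
      rw [integral_sub (integrable_mul_test hf hφ' hφc.deriv)
        (integrable_mul_test hGc.locallyIntegrable hφ' hφc.deriv), p.2 φ hφ hφc,
        hG.integral_mul_deriv_test hg hφ hφc, sub_self]
  refine ⟨fun x => G x + c, ?_, fun x y => ?_⟩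
  · filter_upwards [hc] with x hx
    linarith
  · rw [← hG x y]; ring

/-- `F` is a continuous representative of an `H¹` function with derivative `g`. -/
structure IsH1Pair (F g : ℝ → ℝ) : Prop where
  memLp : MemLp F 2
  memLp_deriv : MemLp g 2
  isPrimitive : IsPrimitive F g

namespace IsH1Pair

variable {F g : ℝ → ℝ}

theorem locallyIntegrable_deriv (h : IsH1Pair F g) : LocallyIntegrable g :=
  h.memLp_deriv.locallyIntegrable (by norm_num)

theorem continuous (h : IsH1Pair F g) : Continuous F :=
  h.isPrimitive.continuous h.locallyIntegrable_deriv

/-- The element of `H¹(ℝ)` given by a representative. -/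
noncomputable def toH1 (h : IsH1Pair F g) : H1 :=
  ⟨WithLp.toLp 2 (h.memLp.toLp F, h.memLp_deriv.toLp g), by
    intro φ hφ hc
    have e1 : ∫ x, (h.memLp.toLp F) x * deriv φ x = ∫ x, F x * deriv φ x := by
      refine integral_congr_ae ?_
      filter_upwards [h.memLp.coeFn_toLp] with x hx
      rw [hx]
    have e2 : ∫ x, (h.memLp_deriv.toLp g) x * φ x = ∫ x, g x * φ x := by
      refine integral_congr_ae ?_
      filter_upwards [h.memLp_deriv.coeFn_toLp] with x hx
      rw [hx]
    change ∫ x, (h.memLp.toLp F) x * deriv φ x = - ∫ x, (h.memLp_deriv.toLp g) x * φ x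
    rw [e1, e2, h.isPrimitive.integral_mul_deriv_test h.locallyIntegrable_deriv hφ hc]⟩

theorem toH1_fn (h : IsH1Pair F g) : h.toH1.fn =ᵐ[volume] F := h.memLp.coeFn_toLp

end IsH1Pair

theorem Lp.norm_sq_eq_integral (f : Lp ℝ 2 (volume : Measure ℝ)) : ‖f‖ ^ 2 = ∫ x, f x ^ 2 := by
  rw [← real_inner_self_eq_norm_sq, L2.inner_def]
  simp [pow_two]

theorem H1.norm_sq (p : H1) :
    ‖p‖ ^ 2 = (∫ x, p.val.fst x ^ 2) + ∫ x, p.val.snd x ^ 2 := by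
  rw [← Lp.norm_sq_eq_integral, ← Lp.norm_sq_eq_integral]
  exact WithLp.prod_norm_sq_eq_of_L2 p.val

theorem IsH1Pair.norm_toH1_sq {F g : ℝ → ℝ} (h : IsH1Pair F g) :
    ‖h.toH1‖ ^ 2 = (∫ x, F x ^ 2) + ∫ x, g x ^ 2 := by
  rw [H1.norm_sq]
  congr 1
  · refine integral_congr_ae ?_
    filter_upwards [h.memLp.coeFn_toLp] with x hx
    exact congrArg (· ^ 2) hx
  · refine integral_congr_ae ?_
    filter_upwards [h.memLp_deriv.coeFn_toLp] with x hx
    exact congrArg (· ^ 2) hx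

/-- The continuous representative of an element of `H¹(ℝ)`. -/
noncomputable def H1.rep (p : H1) : ℝ → ℝ := p.exists_isPrimitive.choose

theorem H1.rep_ae_eq (p : H1) : p.rep =ᵐ[volume] p.fn := p.exists_isPrimitive.choose_spec.1

theorem H1.isH1Pair (p : H1) : IsH1Pair p.rep p.val.snd where
  memLp := (memLp_congr_ae p.rep_ae_eq).2 (Lp.memLp p.val.fst)
  memLp_deriv := Lp.memLp p.val.snd
  isPrimitive := p.exists_isPrimitive.choose_spec.2

theorem H1.continuous_rep (p : H1) : Continuous p.rep := p.isH1Pair.continuous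

theorem H1.rep_eq_of_ae_eq (p : H1) {F : ℝ → ℝ} (hF : Continuous F) (h : p.fn =ᵐ[volume] F) :
    p.rep = F :=
  (p.continuous_rep.ae_eq_iff_eq volume hF).1 (p.rep_ae_eq.trans h)

/-- The weak derivative is almost everywhere the classical derivative of the representative, so the
representative determines both components. Identities in `H1` can thus be checked pointwise. -/
theorem H1.ext_rep {p q : H1} (h : p.rep = q.rep) : p = q := by
  have h1 : p.val.fst = q.val.fst := Lp.ext (p.rep_ae_eq.symm.trans (h ▸ q.rep_ae_eq))
  have h2 : p.val.snd = q.val.snd := by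
    refine Lp.ext ?_
    filter_upwards [p.isH1Pair.isPrimitive.ae_hasDerivAt p.isH1Pair.locallyIntegrable_deriv,
      q.isH1Pair.isPrimitive.ae_hasDerivAt q.isH1Pair.locallyIntegrable_deriv] with x hx hx'
    rw [h] at hx
    exact hx.unique hx'
  exact Subtype.ext (WithLp.ofLp_injective 2 (Prod.ext h1 h2))

theorem IsH1Pair.rep_toH1 {F g : ℝ → ℝ} (h : IsH1Pair F g) : h.toH1.rep = F :=
  h.toH1.rep_eq_of_ae_eq h.continuous h.toH1_fn

theorem H1.rep_add (p q : H1) : (p + q).rep = p.rep + q.rep := by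
  refine H1.rep_eq_of_ae_eq _ (p.continuous_rep.add q.continuous_rep) ?_
  filter_upwards [Lp.coeFn_add p.val.fst q.val.fst, p.rep_ae_eq, q.rep_ae_eq] with x h1 h2 h3
  rw [Pi.add_apply, h2, h3]
  exact h1

theorem H1.rep_smul (c : ℝ) (p : H1) : (c • p).rep = c • p.rep := by
  refine H1.rep_eq_of_ae_eq _ (p.continuous_rep.const_smul c) ?_
  filter_upwards [Lp.coeFn_smul c p.val.fst, p.rep_ae_eq] with x h1 h2
  rw [Pi.smul_apply, h2]
  exact h1

/-! ### The Sobolev embedding and point evaluation. -/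

/-- Cauchy–Schwarz, obtained by integrating `2|f| ≤ c + f²/c` and optimising over `c > 0`. When `f`
has zero `L²` norm the optimum is not attained and `c` is sent to zero instead. -/
theorem integral_abs_interval_le {f : ℝ → ℝ} (hf : MemLp f 2) {a b : ℝ} (hab : a ≤ b) :
    ∫ t in a..b, |f t| ≤ Real.sqrt (b - a) * Real.sqrt (∫ x, f x ^ 2) := by
  have h1 : ∀ c : ℝ, 0 < c →
      2 * ∫ t in a..b, |f t| ≤ c * (b - a) + c⁻¹ * ∫ x, f x ^ 2 := by
    intro c hc
    have hi : IntervalIntegrable (fun t => |f t|) volume a b :=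
      ((hf.locallyIntegrable (by norm_num)).intervalIntegrable (a := a) (b := b)).abs
    have hs : Integrable (fun t => f t ^ 2) := hf.integrable_sq
    have e : ∫ t in a..b, (c + c⁻¹ * f t ^ 2) = c * (b - a) + c⁻¹ * ∫ t in a..b, f t ^ 2 := by
      rw [intervalIntegral.integral_add (by simp) (hs.intervalIntegrable.const_mul _)]
      simp [mul_comm]
    have h2 : ∫ t in a..b, f t ^ 2 ≤ ∫ t, f t ^ 2 := by
      rw [intervalIntegral.integral_of_le hab]
      exact setIntegral_le_integral hs (Eventually.of_forall fun t => sq_nonneg _)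
    have h3 : ∫ t in a..b, 2 * |f t| ≤ ∫ t in a..b, (c + c⁻¹ * f t ^ 2) := by
      refine intervalIntegral.integral_mono_on hab (hi.const_mul 2)
        ((by simp : IntervalIntegrable (fun _ => c) volume a b).add
          (hs.intervalIntegrable.const_mul _)) fun t _ => ?_
      have : 0 ≤ c⁻¹ * (c - |f t|) ^ 2 := by positivity
      have e2 : c⁻¹ * (c - |f t|) ^ 2 = c + c⁻¹ * f t ^ 2 - 2 * |f t| := by
        rw [← sq_abs (f t)]; field_simp; ring
      linarith
    rw [intervalIntegral.integral_const_mul, e] at h3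
    have : c⁻¹ * ∫ t in a..b, f t ^ 2 ≤ c⁻¹ * ∫ t, f t ^ 2 := by gcongr
    linarith
  rcases hab.eq_or_lt with rfl | hlt
  · simp
  have hl : 0 < b - a := sub_pos.2 hlt
  set A := ∫ x, f x ^ 2 with hA
  have hA0 : 0 ≤ A := integral_nonneg fun x => sq_nonneg _
  rcases hA0.eq_or_lt with h0 | hpos
  · rw [← h0, Real.sqrt_zero, mul_zero]
    refine le_of_forall_pos_le_add fun ε hε => ?_
    have := h1 (ε / (b - a)) (by positivity)
    rw [← h0, div_mul_cancel₀ _ hl.ne'] at this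
    linarith
  · have := h1 (Real.sqrt A / Real.sqrt (b - a)) (by positivity)
    have e1 : Real.sqrt A / Real.sqrt (b - a) * (b - a) = Real.sqrt (b - a) * Real.sqrt A := by
      have := Real.mul_self_sqrt hl.le
      field_simp
      nlinarith
    have e2 : (Real.sqrt A / Real.sqrt (b - a))⁻¹ * A = Real.sqrt (b - a) * Real.sqrt A := by
      have := Real.mul_self_sqrt hA0
      field_simp
      nlinarith
    linarith

theorem IsH1Pair.abs_sub_le {F g : ℝ → ℝ} (h : IsH1Pair F g) (x y : ℝ) :
    |F y - F x| ≤ Real.sqrt |y - x| * Real.sqrt (∫ t, g t ^ 2) := by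
  wlog hxy : x ≤ y generalizing x y
  · rw [abs_sub_comm, abs_sub_comm y x]; exact this y x (not_le.1 hxy).le
  rw [h.isPrimitive, abs_of_nonneg (sub_nonneg.2 hxy)]
  exact (intervalIntegral.abs_integral_le_integral_abs hxy).trans
    (integral_abs_interval_le h.memLp_deriv hxy)

/-- On `[x, x + 1]` the Hölder estimate compares `F x` with `F t`; averaging over `t` bounds it by
the two `L²` norms. -/
theorem IsH1Pair.abs_le {F g : ℝ → ℝ} (h : IsH1Pair F g) (x : ℝ) :
    |F x| ≤ Real.sqrt (∫ t, F t ^ 2) + Real.sqrt (∫ t, g t ^ 2) := by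
  have h1 : ∀ t ∈ Icc x (x + 1), |F x| ≤ |F t| + Real.sqrt (∫ t, g t ^ 2) := by
    intro t ht
    have h2 := h.abs_sub_le x t
    have h3 : Real.sqrt |t - x| ≤ 1 := by
      rw [Real.sqrt_le_one, abs_of_nonneg (sub_nonneg.2 ht.1)]
      linarith [ht.2]
    have h4 := mul_le_of_le_one_left (Real.sqrt_nonneg (∫ t, g t ^ 2)) h3
    have h5 := abs_sub_abs_le_abs_sub (F x) (F t)
    rw [abs_sub_comm] at h5
    linarith
  have hle : x ≤ x + 1 := by linarith
  have h6 : ∫ t in x..(x + 1), |F x| ≤ ∫ t in x..(x + 1), (|F t| + Real.sqrt (∫ t, g t ^ 2)) :=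
    intervalIntegral.integral_mono_on hle (by simp)
      ((h.continuous.abs.add continuous_const).intervalIntegrable _ _) h1
  rw [intervalIntegral.integral_add (h.continuous.abs.intervalIntegrable _ _) (by simp)] at h6
  simp only [intervalIntegral.integral_const, smul_eq_mul] at h6
  have h7 := integral_abs_interval_le h.memLp hle
  simp only [add_sub_cancel_left, Real.sqrt_one, one_mul] at h6 h7
  linarith

theorem H1.norm_deriv_le (p : H1) : Real.sqrt (∫ t, p.val.snd t ^ 2) ≤ ‖p‖ := by
  rw [Real.sqrt_le_left (norm_nonneg _), H1.norm_sq]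
  have : 0 ≤ ∫ x, p.val.fst x ^ 2 := integral_nonneg fun x => sq_nonneg _
  linarith

theorem H1.norm_fst_le (p : H1) : Real.sqrt (∫ t, p.rep t ^ 2) ≤ ‖p‖ := by
  have : ∫ t, p.rep t ^ 2 = ∫ t, p.val.fst t ^ 2 := integral_congr_ae (by
    filter_upwards [p.rep_ae_eq] with x hx
    exact congrArg (· ^ 2) hx)
  rw [this, Real.sqrt_le_left (norm_nonneg _), H1.norm_sq]
  have : 0 ≤ ∫ x, p.val.snd x ^ 2 := integral_nonneg fun x => sq_nonneg _
  linarith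

theorem H1.abs_rep_le (p : H1) (x : ℝ) : |p.rep x| ≤ 2 * ‖p‖ := by
  have := p.isH1Pair.abs_le x
  linarith [p.norm_deriv_le, p.norm_fst_le]

/-- Point evaluation on `H¹(ℝ)`. -/
noncomputable def H1.evalCLM (x : ℝ) : H1 →L[ℝ] ℝ :=
  LinearMap.mkContinuous
    { toFun := fun p => p.rep x
      map_add' := fun p q => by rw [H1.rep_add]; rfl
      map_smul' := fun c p => by rw [H1.rep_smul]; rfl } 2 fun p => p.abs_rep_le x

@[simp] theorem H1.evalCLM_apply (x : ℝ) (p : H1) : H1.evalCLM x p = p.rep x := rfl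

/-! ### Completeness and weak limits. -/

theorem Lp.real_inner_toLp {φ : ℝ → ℝ} (hφ : MemLp φ 2) (f : Lp ℝ 2 (volume : Measure ℝ)) :
    inner ℝ (hφ.toLp φ) f = ∫ x, f x * φ x := by
  rw [L2.inner_def]
  refine integral_congr_ae ?_
  filter_upwards [hφ.coeFn_toLp] with x hx
  simp [hx]

theorem isClosed_h1Submodule : IsClosed (h1Submodule : Set
    (WithLp 2 (Lp ℝ 2 (volume : Measure ℝ) × Lp ℝ 2 (volume : Measure ℝ)))) := by
  have : (h1Submodule : Set
      (WithLp 2 (Lp ℝ 2 (volume : Measure ℝ) × Lp ℝ 2 (volume : Measure ℝ)))) =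
      ⋂ (φ : ℝ → ℝ) (_ : ContDiff ℝ ∞ φ) (_ : HasCompactSupport φ),
        {p | ∫ x, p.fst x * deriv φ x = - ∫ x, p.snd x * φ x} := by
    ext p
    simp only [mem_iInter]
    rfl
  rw [this]
  refine isClosed_iInter fun φ => isClosed_iInter fun hφ => isClosed_iInter fun hc => ?_
  have h1 : MemLp φ 2 := hφ.continuous.memLp_of_hasCompactSupport hc
  have h2 : MemLp (deriv φ) 2 :=
    (hφ.continuous_deriv (by simp)).memLp_of_hasCompactSupport hc.deriv
  simp only [← Lp.real_inner_toLp h1, ← Lp.real_inner_toLp h2]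
  have c1 : Continuous fun p : WithLp 2 (Lp ℝ 2 (volume : Measure ℝ) ×
      Lp ℝ 2 (volume : Measure ℝ)) => p.fst := (WithLp.fstL 2 ℝ _ _).continuous
  have c2 : Continuous fun p : WithLp 2 (Lp ℝ 2 (volume : Measure ℝ) ×
      Lp ℝ 2 (volume : Measure ℝ)) => p.snd := (WithLp.sndL 2 ℝ _ _).continuous
  exact isClosed_eq (continuous_const.inner c1) (continuous_const.inner c2).neg

instance H1.instCompleteSpace : CompleteSpace H1 :=
  isClosed_h1Submodule.completeSpace_coe

/-- A bounded sequence in `H¹(ℝ)` whose representatives converge pointwise has its limit in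
`H¹(ℝ)`, with the same bound. -/
theorem H1.exists_of_tendsto_of_bounded (w : ℕ → H1) (B : ℝ) (hB : ∀ n, ‖w n‖ ≤ B) (l : ℝ → ℝ)
    (h : ∀ x, Tendsto (fun n => (w n).rep x) atTop (𝓝 (l x))) :
    ∃ p : H1, ‖p‖ ≤ B ∧ p.rep = l := by
  -- By the Riesz isomorphism the sequence lives in a ball of the dual, where Banach–Alaoglu
  -- provides a limit along an ultrafilter finer than `atTop`. Evaluation at `x` is itself an inner
  -- product, so this limit must agree with the pointwise one.
  let f : ℕ → WeakDual ℝ H1 := fun n =>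
    StrongDual.toWeakDual (InnerProductSpace.toDual ℝ H1 (w n))
  obtain ⟨ξ, hξ, hlim⟩ := (WeakDual.isCompact_closedBall (𝕜 := ℝ) (E := H1) 0 B).ultrafilter_le_nhds'
    ((hyperfilter ℕ).map f) (by
      refine Ultrafilter.mem_map.2 (Filter.univ_mem' fun n => ?_)
      have hn : ‖InnerProductSpace.toDual ℝ H1 (w n)‖ ≤ B :=
        ((InnerProductSpace.toDual ℝ H1).norm_map (w n)).trans_le (hB n)
      exact (dist_zero_right (E := StrongDual ℝ H1) _).trans_le hn)
  let p : H1 := (InnerProductSpace.toDual ℝ H1).symm (WeakDual.toStrongDual ξ)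
  have hp : ∀ z, inner ℝ p z = ξ z := fun z => InnerProductSpace.toDual_symm_apply
  refine ⟨p, ?_, funext fun x => ?_⟩
  · rw [LinearIsometryEquiv.norm_map]
    exact (dist_zero_right (E := StrongDual ℝ H1) _).symm.trans_le hξ
  · let z : H1 := (InnerProductSpace.toDual ℝ H1).symm (H1.evalCLM x)
    have hz : ∀ q : H1, inner ℝ q z = q.rep x := fun q => by
      rw [real_inner_comm]; exact InnerProductSpace.toDual_symm_apply
    have t1 : Tendsto (fun n => f n z) (hyperfilter ℕ) (𝓝 (ξ z)) :=
      ((WeakDual.eval_continuous z).tendsto ξ).comp hlim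
    have t2 : Tendsto (fun n => f n z) (hyperfilter ℕ) (𝓝 (l x)) := by
      have : ∀ n, f n z = (w n).rep x := fun n => hz (w n)
      simp only [this]
      exact (h x).mono_left (Nat.hyperfilter_le_atTop)
    rw [← hz p, hp]
    exact tendsto_nhds_unique t1 t2

/-! ### Products in `H¹`. -/

/-- Integrable `H¹` functions with integrable derivative. -/
structure IsW1Pair (F g : ℝ → ℝ) : Prop extends IsH1Pair F g where
  integrable : Integrable F
  integrable_deriv : Integrable g

theorem memLp_mul_of_abs_le {F G : ℝ → ℝ} {c : ℝ} (hF : AEStronglyMeasurable F)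
    (hc : ∀ x, |F x| ≤ c) (hG : MemLp G 2) : MemLp (fun x => F x * G x) 2 :=
  (hG.const_mul c).mono (hF.mul hG.1) (Eventually.of_forall fun x => by
    have h0 := (abs_nonneg (F x)).trans (hc x)
    rw [Real.norm_eq_abs, Real.norm_eq_abs, abs_mul, abs_mul, abs_of_nonneg h0]
    gcongr
    exact hc x)

theorem integral_mul_sq_le {F G : ℝ → ℝ} {c : ℝ} (hc : ∀ x, |F x| ≤ c) (hG : MemLp G 2) :
    ∫ x, (F x * G x) ^ 2 ≤ c ^ 2 * ∫ x, G x ^ 2 := by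
  rw [← integral_const_mul]
  refine integral_mono_of_nonneg (Eventually.of_forall fun x => sq_nonneg _)
    (hG.integrable_sq.const_mul _) (Eventually.of_forall fun x => ?_)
  change (F x * G x) ^ 2 ≤ c ^ 2 * G x ^ 2
  rw [mul_pow]
  gcongr ?_ * _
  exact sq_le_sq' (neg_le_of_abs_le (hc x)) (le_of_abs_le (hc x))

theorem IsH1Pair.mul {F f G g : ℝ → ℝ} (hF : IsH1Pair F f) (hG : IsH1Pair G g) :
    IsW1Pair (fun x => F x * G x) (fun x => f x * G x + F x * g x) where
  memLp := memLp_mul_of_abs_le hF.memLp.1 hF.abs_le hG.memLp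
  memLp_deriv := by
    refine MemLp.add ?_ (memLp_mul_of_abs_le hF.memLp.1 hF.abs_le hG.memLp_deriv)
    simpa only [mul_comm] using memLp_mul_of_abs_le hG.memLp.1 hG.abs_le hF.memLp_deriv
  isPrimitive := hF.isPrimitive.mul hF.locallyIntegrable_deriv hG.isPrimitive
    hG.locallyIntegrable_deriv
  integrable := hF.memLp.integrable_mul hG.memLp
  integrable_deriv := (hF.memLp_deriv.integrable_mul hG.memLp).add
    (hF.memLp.integrable_mul hG.memLp_deriv)

theorem H1.isW1Pair_mul (p q : H1) : IsW1Pair (fun x => p.rep x * q.rep x)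
    (fun x => p.val.snd x * q.rep x + p.rep x * q.val.snd x) := p.isH1Pair.mul q.isH1Pair

theorem H1.integral_deriv_sq_le (p : H1) : ∫ t, p.val.snd t ^ 2 ≤ ‖p‖ ^ 2 :=
  (Real.sqrt_le_left (norm_nonneg _)).1 p.norm_deriv_le

theorem H1.integral_rep_sq_le (p : H1) : ∫ t, p.rep t ^ 2 ≤ ‖p‖ ^ 2 :=
  (Real.sqrt_le_left (norm_nonneg _)).1 p.norm_fst_le

/-- With sup norms at most twice the `H¹` norms, the squared norm of the product costs `4` for the
function and `2 · (4 + 4)` for its derivative, and `20 ≤ 5²`. -/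
theorem H1.norm_mul_le (p q : H1) : ‖(p.isW1Pair_mul q).toH1‖ ≤ 5 * ‖p‖ * ‖q‖ := by
  refine abs_le_of_sq_le_sq' ?_ (by positivity) |>.2
  rw [IsH1Pair.norm_toH1_sq]
  have hfq : MemLp (fun x => q.rep x * p.val.snd x) 2 :=
    memLp_mul_of_abs_le q.isH1Pair.memLp.1 q.abs_rep_le p.isH1Pair.memLp_deriv
  have hpg : MemLp (fun x => p.rep x * q.val.snd x) 2 :=
    memLp_mul_of_abs_le p.isH1Pair.memLp.1 p.abs_rep_le q.isH1Pair.memLp_deriv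
  have h1 := integral_mul_sq_le p.abs_rep_le q.isH1Pair.memLp
  have h2 := integral_mul_sq_le p.abs_rep_le q.isH1Pair.memLp_deriv
  have h3 := integral_mul_sq_le q.abs_rep_le p.isH1Pair.memLp_deriv
  have h4 : ∫ x, (p.val.snd x * q.rep x + p.rep x * q.val.snd x) ^ 2 ≤
      2 * (∫ x, (q.rep x * p.val.snd x) ^ 2) + 2 * ∫ x, (p.rep x * q.val.snd x) ^ 2 := by
    rw [← integral_const_mul, ← integral_const_mul,
      ← integral_add (hfq.integrable_sq.const_mul 2) (hpg.integrable_sq.const_mul 2)]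
    refine integral_mono_of_nonneg (Eventually.of_forall fun x => sq_nonneg _)
      ((hfq.integrable_sq.const_mul 2).add (hpg.integrable_sq.const_mul 2))
      (Eventually.of_forall fun x => ?_)
    dsimp only
    nlinarith [sq_nonneg (q.rep x * p.val.snd x - p.rep x * q.val.snd x)]
  have k1 := mul_le_mul_of_nonneg_left q.integral_rep_sq_le (sq_nonneg (2 * ‖p‖))
  have k2 := mul_le_mul_of_nonneg_left q.integral_deriv_sq_le (sq_nonneg (2 * ‖p‖))
  have k3 := mul_le_mul_of_nonneg_left p.integral_deriv_sq_le (sq_nonneg (2 * ‖q‖))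
  nlinarith [mul_nonneg (sq_nonneg ‖p‖) (sq_nonneg ‖q‖)]

/-- A bilinear map into `H¹(ℝ)` given by bilinear representatives. -/
noncomputable def H1.bilinOfRep (b : H1 → H1 → ℝ → ℝ)
    (hl : ∀ p p' q, b (p + p') q = b p q + b p' q) (hsl : ∀ (c : ℝ) p q, b (c • p) q = c • b p q)
    (hr : ∀ p q q', b p (q + q') = b p q + b p q') (hsr : ∀ (c : ℝ) p q, b p (c • q) = c • b p q)
    (K : ℝ) (h : ∀ p q, ∃ r : H1, r.rep = b p q ∧ ‖r‖ ≤ K * ‖p‖ * ‖q‖) :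
    H1 →L[ℝ] H1 →L[ℝ] H1 :=
  LinearMap.mkContinuous₂
    (LinearMap.mk₂ ℝ (fun p q => (h p q).choose)
      (fun p p' q => H1.ext_rep (by
        rw [H1.rep_add, (h _ _).choose_spec.1, (h _ _).choose_spec.1, (h _ _).choose_spec.1, hl]))
      (fun c p q => H1.ext_rep (by
        rw [H1.rep_smul, (h _ _).choose_spec.1, (h _ _).choose_spec.1, hsl]))
      (fun p q q' => H1.ext_rep (by
        rw [H1.rep_add, (h _ _).choose_spec.1, (h _ _).choose_spec.1, (h _ _).choose_spec.1, hr]))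
      (fun c p q => H1.ext_rep (by
        rw [H1.rep_smul, (h _ _).choose_spec.1, (h _ _).choose_spec.1, hsr])))
    K fun p q => (h p q).choose_spec.2

theorem H1.rep_bilinOfRep {b : H1 → H1 → ℝ → ℝ} {hl hsl hr hsr K}
    {h : ∀ p q, ∃ r : H1, r.rep = b p q ∧ ‖r‖ ≤ K * ‖p‖ * ‖q‖} (p q : H1) :
    (H1.bilinOfRep b hl hsl hr hsr K h p q).rep = b p q := (h p q).choose_spec.1

/-- Multiplication on `H¹(ℝ)`. -/
noncomputable def H1.mulL : H1 →L[ℝ] H1 →L[ℝ] H1 :=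
  H1.bilinOfRep (fun p q x => p.rep x * q.rep x)
    (fun p p' q => by funext x; simp [H1.rep_add, add_mul])
    (fun c p q => by funext x; simp [H1.rep_smul, mul_assoc])
    (fun p q q' => by funext x; simp [H1.rep_add, mul_add])
    (fun c p q => by funext x; simp [H1.rep_smul, mul_left_comm]) 5
    (fun p q => ⟨(p.isW1Pair_mul q).toH1, IsH1Pair.rep_toH1 _, H1.norm_mul_le p q⟩)

@[simp] theorem H1.rep_mulL (p q : H1) (x : ℝ) : (H1.mulL p q).rep x = p.rep x * q.rep x :=
  congrFun (H1.rep_bilinOfRep (b := fun p q x => p.rep x * q.rep x) p q) x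

/-! ### The conjugate Poisson kernel and its autocorrelation. -/

/-- The conjugate Poisson kernel, up to the factor `1/π`. -/
noncomputable def conjPoissonKernel (ε s : ℝ) : ℝ := s / (s ^ 2 + ε ^ 2)

/-- The Poisson kernel at height `2ε`, up to the factor `1/π`. -/
noncomputable def poissonKernel₂ (ε s : ℝ) : ℝ := 2 * ε / (s ^ 2 + 4 * ε ^ 2)

section Kernel

variable {ε : ℝ}

theorem continuous_conjPoissonKernel (hε : 0 < ε) : Continuous (conjPoissonKernel ε) :=
  continuous_id.div₀ (by fun_prop) fun s => by positivity

theorem conjPoissonKernel_neg (s : ℝ) : conjPoissonKernel ε (-s) = -conjPoissonKernel ε s := by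
  unfold conjPoissonKernel
  rw [neg_sq, neg_div]

theorem abs_conjPoissonKernel_le_inv {s : ℝ} (hs : 0 < s) :
    |conjPoissonKernel ε s| ≤ s⁻¹ := by
  unfold conjPoissonKernel
  rw [abs_of_nonneg (by positivity), div_le_iff₀ (by positivity)]
  field_simp
  nlinarith [sq_nonneg ε]

theorem abs_conjPoissonKernel_le (hε : 0 < ε) (s : ℝ) : |conjPoissonKernel ε s| ≤ ε⁻¹ := by
  unfold conjPoissonKernel
  rw [abs_div, abs_of_pos (by positivity : 0 < s ^ 2 + ε ^ 2), div_le_iff₀ (by positivity),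
    inv_mul_eq_div, le_div_iff₀ hε, ← sq_abs s]
  nlinarith [sq_nonneg (|s| - ε), sq_nonneg ε, sq_nonneg |s|]

theorem integrable_poissonKernel₂ (hε : 0 < ε) : Integrable (poissonKernel₂ ε) := by
  have h := (integrable_inv_one_add_sq.comp_div (R := 2 * ε) (by positivity)).const_mul (2 * ε)⁻¹
  convert! h using 2 with s
  unfold poissonKernel₂
  field_simp
  ring

theorem integral_poissonKernel₂ (hε : 0 < ε) : ∫ s, poissonKernel₂ ε s = Real.pi := by
  have h : ∀ s, poissonKernel₂ ε s = (2 * ε)⁻¹ * (1 + (s / (2 * ε)) ^ 2)⁻¹ := fun s => by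
    unfold poissonKernel₂
    field_simp
    ring
  simp only [h]
  rw [integral_const_mul, Measure.integral_comp_div (fun t : ℝ => (1 + t ^ 2)⁻¹),
    integral_univ_inv_one_add_sq, abs_of_pos (by positivity), smul_eq_mul]
  field_simp

theorem integrable_inv_sq_add_sq (hε : 0 < ε) : Integrable fun s : ℝ => (s ^ 2 + ε ^ 2)⁻¹ := by
  have h := (integrable_inv_one_add_sq.comp_div (R := ε) (by positivity)).const_mul (ε ^ 2)⁻¹
  convert! h using 2 with s
  field_simp
  ring

theorem memLp_conjPoissonKernel (hε : 0 < ε) : MemLp (conjPoissonKernel ε) 2 := by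
  rw [memLp_two_iff_integrable_sq (continuous_conjPoissonKernel hε).aestronglyMeasurable]
  refine (integrable_inv_sq_add_sq hε).mono'
    ((continuous_conjPoissonKernel hε).pow 2).aestronglyMeasurable
    (Eventually.of_forall fun s => ?_)
  rw [Real.norm_eq_abs, abs_of_nonneg (sq_nonneg _)]
  unfold conjPoissonKernel
  rw [div_pow, div_le_iff₀ (by positivity)]
  field_simp
  nlinarith [sq_nonneg ε]

theorem tendsto_log_sub_log {l : Filter ℝ} (hl : Tendsto (fun s : ℝ => s⁻¹) l (𝓝 0))
    (h0 : ∀ᶠ s in l, s ≠ 0) (hε : 0 < ε) (d : ℝ) :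
    Tendsto (fun s => Real.log (s ^ 2 + ε ^ 2) - Real.log ((s + d) ^ 2 + ε ^ 2)) l (𝓝 0) := by
  -- The substitution `t = s⁻¹` turns both limits at infinity into continuity at `0`.
  have hc : ContinuousAt (fun t : ℝ => Real.log ((1 + ε ^ 2 * t ^ 2) /
      ((1 + d * t) ^ 2 + ε ^ 2 * t ^ 2))) 0 := by
    refine ContinuousAt.log (ContinuousAt.div (by fun_prop) (by fun_prop) (by simp)) (by simp)
  have h1 := hc.tendsto.comp hl
  simp only [ne_eq, OfNat.ofNat_ne_zero, not_false_eq_true, zero_pow, mul_zero, add_zero, one_pow,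
    div_one, Real.log_one] at h1
  refine h1.congr' ?_
  filter_upwards [h0] with s hs
  rw [← Real.log_div (by positivity) (by positivity)]
  simp only [Function.comp_apply]
  congr 1
  have : s ^ 2 + ε ^ 2 ≠ 0 := by positivity
  have e1 : 1 + ε ^ 2 * s⁻¹ ^ 2 = (s ^ 2 + ε ^ 2) / s ^ 2 := by field_simp
  have e2 : (1 + d * s⁻¹) ^ 2 + ε ^ 2 * s⁻¹ ^ 2 = ((s + d) ^ 2 + ε ^ 2) / s ^ 2 := by field_simp
  rw [e1, e2, div_div_div_cancel_right₀ (by positivity)]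

/-- Partial fractions give an explicit antiderivative made of logarithms and arctangents. The
logarithms cancel at both ends, so only the arctangents contribute. The coefficient `α` has `d` in
its denominator, whence `d ≠ 0`. -/
theorem integral_conjPoissonKernel_mul (hε : 0 < ε) {d : ℝ} (hd : d ≠ 0) :
    ∫ s, conjPoissonKernel ε s * conjPoissonKernel ε (s + d) = Real.pi * poissonKernel₂ ε d := by
  set β : ℝ := ε ^ 2 / (d ^ 2 + 4 * ε ^ 2) with hβ
  set α : ℝ := (d ^ 2 + 2 * ε ^ 2) / (d * (d ^ 2 + 4 * ε ^ 2)) with hα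
  have hder : ∀ s, HasDerivAt (fun s => α / 2 * (Real.log (s ^ 2 + ε ^ 2) -
      Real.log ((s + d) ^ 2 + ε ^ 2)) + β / ε * (Real.arctan (s / ε) + Real.arctan ((s + d) / ε)))
      (conjPoissonKernel ε s * conjPoissonKernel ε (s + d)) s := by
    intro s
    have l1 : HasDerivAt (fun s : ℝ => s ^ 2 + ε ^ 2) (2 * s) s := by
      simpa using (hasDerivAt_pow 2 s).add_const (ε ^ 2)
    have l2 : HasDerivAt (fun s : ℝ => (s + d) ^ 2 + ε ^ 2) (2 * (s + d)) s := by
      simpa using (((hasDerivAt_id s).add_const d).pow 2).add_const (ε ^ 2)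
    have l3 : HasDerivAt (fun s : ℝ => s / ε) (1 / ε) s := (hasDerivAt_id s).div_const ε
    have l4 : HasDerivAt (fun s : ℝ => (s + d) / ε) (1 / ε) s :=
      ((hasDerivAt_id s).add_const d).div_const ε
    have h := (((l1.log (by positivity)).sub (l2.log (by positivity))).const_mul (α / 2)).add
      ((l3.arctan.add l4.arctan).const_mul (β / ε))
    convert! h using 1
    rw [hα, hβ]
    unfold conjPoissonKernel
    have h1 : s ^ 2 + ε ^ 2 ≠ 0 := by positivity
    have h2 : (s + d) ^ 2 + ε ^ 2 ≠ 0 := by positivity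
    have h3 : d ^ 2 + 4 * ε ^ 2 ≠ 0 := by positivity
    have e1 : 1 / (1 + (s / ε) ^ 2) * (1 / ε) = ε / (s ^ 2 + ε ^ 2) := by
      field_simp
      ring
    have e2 : 1 / (1 + ((s + d) / ε) ^ 2) * (1 / ε) = ε / ((s + d) ^ 2 + ε ^ 2) := by
      field_simp
      ring
    rw [e1, e2]
    field_simp
    ring
  have hint : Integrable fun s => conjPoissonKernel ε s * conjPoissonKernel ε (s + d) :=
    (memLp_conjPoissonKernel hε).integrable_mul
      ((memLp_conjPoissonKernel hε).comp_measurePreserving (measurePreserving_add_right volume d))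
  have key : ∀ (l : Filter ℝ) (c : ℝ), Tendsto (fun s : ℝ => s⁻¹) l (𝓝 0) → (∀ᶠ s in l, s ≠ 0) →
      Tendsto (fun s => Real.arctan (s / ε)) l (𝓝 c) →
      Tendsto (fun s => Real.arctan ((s + d) / ε)) l (𝓝 c) →
      Tendsto (fun s => α / 2 * (Real.log (s ^ 2 + ε ^ 2) - Real.log ((s + d) ^ 2 + ε ^ 2)) +
        β / ε * (Real.arctan (s / ε) + Real.arctan ((s + d) / ε))) l
        (𝓝 (α / 2 * 0 + β / ε * (c + c))) := fun l c h1 h2 h3 h4 =>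
    ((tendsto_log_sub_log h1 h2 hε d).const_mul _).add ((h3.add h4).const_mul _)
  rw [integral_of_hasDerivAt_of_tendsto hder hint
    (key atBot (-(Real.pi / 2)) tendsto_inv_atBot_zero (eventually_ne_atBot 0)
      ((Real.tendsto_arctan_atBot.mono_right nhdsWithin_le_nhds).comp
        (tendsto_id.atBot_div_const hε))
      ((Real.tendsto_arctan_atBot.mono_right nhdsWithin_le_nhds).comp
        ((tendsto_atBot_add_const_right _ d tendsto_id).atBot_div_const hε)))
    (key atTop (Real.pi / 2) tendsto_inv_atTop_zero (eventually_ne_atTop 0)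
      ((Real.tendsto_arctan_atTop.mono_right nhdsWithin_le_nhds).comp
        (tendsto_id.atTop_div_const hε))
      ((Real.tendsto_arctan_atTop.mono_right nhdsWithin_le_nhds).comp
        ((tendsto_atTop_add_const_right _ d tendsto_id).atTop_div_const hε)))]
  rw [hβ]
  unfold poissonKernel₂
  field_simp
  ring

end Kernel

/-! ### The uniform `L²` bound for conjugate Poisson integrals. -/

/-- The conjugate Poisson integral of `f`, up to the factor `1/π`. -/
noncomputable def conjPoisson (ε : ℝ) (f : ℝ → ℝ) (x : ℝ) : ℝ :=
  ∫ y, f y * conjPoissonKernel ε (x - y)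

section ConjPoisson

variable {ε : ℝ} {f : ℝ → ℝ}

theorem aestronglyMeasurable_conjPoisson (hε : 0 < ε) (hf : Integrable f) :
    AEStronglyMeasurable (conjPoisson ε f) := by
  refine AEStronglyMeasurable.integral_prod_right' (μ := volume) (ν := volume)
    (f := fun p : ℝ × ℝ => f p.2 * conjPoissonKernel ε (p.1 - p.2)) ?_
  exact hf.1.comp_snd.mul ((continuous_conjPoissonKernel hε).comp
    (continuous_fst.sub continuous_snd)).aestronglyMeasurable

/-- Integrating in the first variable first, the two translated kernels contribute at most `∫ K²`
whatever the shifts, leaving the integrable product `|f| ⊗ |f|`. This is what licenses Fubini for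
the square of the convolution. -/
theorem integrable_mul_mul_conjPoissonKernel (hε : 0 < ε) (hf : Integrable f) :
    Integrable (fun p : ℝ × (ℝ × ℝ) => (f p.2.1 * conjPoissonKernel ε (p.1 - p.2.1)) *
      (f p.2.2 * conjPoissonKernel ε (p.1 - p.2.2))) (volume.prod (volume.prod volume)) := by
  have hc := continuous_conjPoissonKernel hε
  have hq := memLp_conjPoissonKernel hε
  have hs : ∀ y : ℝ, MemLp (fun x => conjPoissonKernel ε (x - y)) 2 := fun y =>
    hq.comp_measurePreserving (measurePreserving_sub_right volume y)
  have hm : AEStronglyMeasurable (fun p : ℝ × (ℝ × ℝ) =>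
      (f p.2.1 * conjPoissonKernel ε (p.1 - p.2.1)) *
      (f p.2.2 * conjPoissonKernel ε (p.1 - p.2.2))) (volume.prod (volume.prod volume)) := by
    refine AEStronglyMeasurable.mul (AEStronglyMeasurable.mul ?_ ?_)
      (AEStronglyMeasurable.mul ?_ ?_)
    · exact (hf.1.comp_fst (ν := volume)).comp_snd (μ := volume)
    · exact (hc.comp (by fun_prop)).aestronglyMeasurable
    · exact (hf.1.comp_snd (μ := volume)).comp_snd (μ := volume)
    · exact (hc.comp (by fun_prop)).aestronglyMeasurable
  have hi : ∀ y z : ℝ, Integrable fun x => conjPoissonKernel ε (x - y) *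
      conjPoissonKernel ε (x - z) := fun y z => (hs y).integrable_mul (hs z)
  rw [integrable_prod_iff' hm]
  refine ⟨Eventually.of_forall fun q => ?_, ?_⟩
  · refine ((hi q.1 q.2).const_mul (f q.1 * f q.2)).congr (Eventually.of_forall fun x => ?_)
    dsimp only; ring
  · refine Integrable.mono' (g := fun q : ℝ × ℝ => |f q.1| * |f q.2| *
      ∫ s, conjPoissonKernel ε s ^ 2) ((hf.abs.mul_prod hf.abs).mul_const _)
      hm.norm.prod_swap.integral_prod_right' (Eventually.of_forall fun q => ?_)
    rw [Real.norm_eq_abs, abs_of_nonneg (integral_nonneg fun _ => norm_nonneg _)]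
    have e : ∀ x, ‖(f q.1 * conjPoissonKernel ε (x - q.1)) *
        (f q.2 * conjPoissonKernel ε (x - q.2))‖ = |f q.1| * |f q.2| *
          |conjPoissonKernel ε (x - q.1) * conjPoissonKernel ε (x - q.2)| := fun x => by
      simp only [Real.norm_eq_abs, abs_mul]; ring
    simp only [e]
    rw [integral_const_mul]
    refine mul_le_mul_of_nonneg_left ?_ (by positivity)
    have b : ∫ x, |conjPoissonKernel ε (x - q.1) * conjPoissonKernel ε (x - q.2)| ≤
        ∫ x, (conjPoissonKernel ε (x - q.1) ^ 2 / 2 + conjPoissonKernel ε (x - q.2) ^ 2 / 2) := by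
      refine integral_mono (hi _ _).abs (((hs q.1).integrable_sq.div_const 2).add
        ((hs q.2).integrable_sq.div_const 2)) fun x => ?_
      dsimp only
      rw [abs_mul, ← sq_abs (conjPoissonKernel ε (x - q.1)),
        ← sq_abs (conjPoissonKernel ε (x - q.2))]
      nlinarith [sq_nonneg (|conjPoissonKernel ε (x - q.1)| - |conjPoissonKernel ε (x - q.2)|)]
    rw [integral_add ((hs q.1).integrable_sq.div_const 2) ((hs q.2).integrable_sq.div_const 2),
      integral_div, integral_div,
      integral_sub_right_eq_self (fun s => conjPoissonKernel ε s ^ 2),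
      integral_sub_right_eq_self (fun s => conjPoissonKernel ε s ^ 2)] at b
    linarith

theorem conjPoisson_sq (x : ℝ) :
    conjPoisson ε f x ^ 2 = ∫ q : ℝ × ℝ, (f q.1 * conjPoissonKernel ε (x - q.1)) *
      (f q.2 * conjPoissonKernel ε (x - q.2)) ∂(volume.prod volume) := by
  rw [integral_prod_mul (fun y => f y * conjPoissonKernel ε (x - y))
    (fun y => f y * conjPoissonKernel ε (x - y)), pow_two]
  rfl

theorem memLp_conjPoisson (hε : 0 < ε) (hf : Integrable f) : MemLp (conjPoisson ε f) 2 := by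
  rw [memLp_two_iff_integrable_sq (aestronglyMeasurable_conjPoisson hε hf)]
  simp only [conjPoisson_sq]
  exact (integrable_mul_mul_conjPoissonKernel hε hf).integral_prod_left

theorem integrable_sq_mul_poissonKernel₂ (hε : 0 < ε) (hf : MemLp f 2) :
    Integrable (fun q : ℝ × ℝ => f q.2 ^ 2 * poissonKernel₂ ε (q.1 - q.2))
      (volume.prod volume) :=
  hf.integrable_sq.convolution_integrand (ContinuousLinearMap.mul ℝ ℝ)
    (integrable_poissonKernel₂ hε)

theorem integral_sq_mul_poissonKernel₂ (hε : 0 < ε) (hf : MemLp f 2) :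
    ∫ q : ℝ × ℝ, f q.2 ^ 2 * poissonKernel₂ ε (q.1 - q.2) ∂(volume.prod volume) =
      Real.pi * ∫ x, f x ^ 2 := by
  rw [integral_prod_symm _ (integrable_sq_mul_poissonKernel₂ hε hf)]
  simp only [integral_const_mul]
  simp only [integral_sub_right_eq_self (poissonKernel₂ ε), integral_poissonKernel₂ hε]
  rw [integral_mul_const, mul_comm]

/-- Expanding the square and integrating in `x` first gives `π ∬ f(y) f(z) P(y - z)` with `P ≥ 0` of
mass `π`. Then `2 f(y) f(z) ≤ f(y)² + f(z)²` finishes, with no Fourier transform and no dependence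
on `ε`. -/
theorem integral_conjPoisson_sq_le (hε : 0 < ε) (hf : Integrable f) (hf2 : MemLp f 2) :
    ∫ x, conjPoisson ε f x ^ 2 ≤ Real.pi ^ 2 * ∫ x, f x ^ 2 := by
  have hI := integrable_mul_mul_conjPoissonKernel hε hf
  have e1 : ∫ x, conjPoisson ε f x ^ 2 = ∫ q : ℝ × ℝ, (∫ x,
      (f q.1 * conjPoissonKernel ε (x - q.1)) * (f q.2 * conjPoissonKernel ε (x - q.2)))
        ∂(volume.prod volume) := by
    simp only [conjPoisson_sq]
    exact integral_integral_swap hI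
  -- The diagonal is null; off it the autocorrelation formula applies.
  have hne : ∀ᵐ q : ℝ × ℝ ∂(volume.prod volume), q.1 - q.2 ≠ 0 := by
    rw [Measure.ae_prod_iff_ae_ae]
    · refine Eventually.of_forall fun x => ?_
      filter_upwards [compl_mem_ae_iff.2 (measure_singleton x)] with y hy
      intro h
      exact hy (sub_eq_zero.1 h).symm
    · exact (isOpen_ne_fun (by fun_prop) continuous_const).measurableSet
  have hA := integrable_sq_mul_poissonKernel₂ hε hf2
  have hB : Integrable (fun q : ℝ × ℝ => f q.1 ^ 2 * poissonKernel₂ ε (q.2 - q.1))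
      (volume.prod volume) := hA.swap
  have iB : ∫ q : ℝ × ℝ, f q.1 ^ 2 * poissonKernel₂ ε (q.2 - q.1) ∂(volume.prod volume) =
      Real.pi * ∫ x, f x ^ 2 := by
    rw [← integral_sq_mul_poissonKernel₂ hε hf2]
    exact integral_prod_swap (fun q : ℝ × ℝ => f q.2 ^ 2 * poissonKernel₂ ε (q.1 - q.2))
  have heven : ∀ s, poissonKernel₂ ε (-s) = poissonKernel₂ ε s := fun s => by
    unfold poissonKernel₂; rw [neg_sq]
  rw [e1]
  have hle : ∀ᵐ q : ℝ × ℝ ∂(volume.prod volume), (∫ x,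
      (f q.1 * conjPoissonKernel ε (x - q.1)) * (f q.2 * conjPoissonKernel ε (x - q.2))) ≤
      Real.pi / 2 * (f q.1 ^ 2 * poissonKernel₂ ε (q.2 - q.1)) +
        Real.pi / 2 * (f q.2 ^ 2 * poissonKernel₂ ε (q.1 - q.2)) := by
    filter_upwards [hne] with q hq
    have e : ∀ x, (f q.1 * conjPoissonKernel ε (x - q.1)) * (f q.2 * conjPoissonKernel ε (x - q.2))
        = f q.1 * f q.2 * (fun s => conjPoissonKernel ε s *
          conjPoissonKernel ε (s + (q.1 - q.2))) (x - q.1) := fun x => by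
      dsimp only
      rw [show x - q.1 + (q.1 - q.2) = x - q.2 by ring]; ring
    simp only [e]
    rw [integral_const_mul, integral_sub_right_eq_self (fun s => conjPoissonKernel ε s *
          conjPoissonKernel ε (s + (q.1 - q.2))), integral_conjPoissonKernel_mul hε hq,
      ← heven (q.1 - q.2), neg_sub]
    have hp : 0 ≤ Real.pi * poissonKernel₂ ε (q.2 - q.1) := by
      unfold poissonKernel₂; have := Real.pi_pos; positivity
    nlinarith [mul_nonneg hp (sq_nonneg (f q.1 - f q.2))]
  refine (integral_mono_ae hI.integral_prod_right
    ((hB.const_mul (Real.pi / 2)).add (hA.const_mul (Real.pi / 2))) hle).trans_eq ?_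
  simp only [Pi.add_apply]
  rw [integral_add (hB.const_mul _) (hA.const_mul _), integral_const_mul, integral_const_mul, iB,
    integral_sq_mul_poissonKernel₂ hε hf2]
  ring

end ConjPoisson

/-! ### The Hilbert transform on products of `H¹` functions. -/

theorem integral_eq_integral_Ioi_add_neg {h : ℝ → ℝ} (hh : Integrable h) :
    ∫ s, h s = ∫ s in Ioi (0 : ℝ), (h s + h (-s)) := by
  rw [integral_add hh.integrableOn hh.comp_neg.integrableOn, integral_comp_neg_Ioi, neg_zero,
    add_comm, intervalIntegral.integral_Iic_add_Ioi hh.integrableOn hh.integrableOn]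

/-- The Hilbert transform, as an absolutely convergent integral. -/
noncomputable def hilb (F : ℝ → ℝ) (x : ℝ) : ℝ :=
  Real.pi⁻¹ * ∫ s in Ioi (0 : ℝ), (F (x - s) - F (x + s)) * s⁻¹

theorem conjPoisson_eq (ε : ℝ) (f : ℝ → ℝ) (x : ℝ) :
    conjPoisson ε f x = ∫ s, f (x - s) * conjPoissonKernel ε s := by
  rw [← integral_sub_left_eq_self (fun s => f (x - s) * conjPoissonKernel ε s) volume x]
  simp only [sub_sub_cancel]
  rfl

theorem integrable_comp_sub_mul_conjPoissonKernel {ε : ℝ} (hε : 0 < ε) {f : ℝ → ℝ}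
    (hf : Integrable f) (x : ℝ) : Integrable fun s => f (x - s) * conjPoissonKernel ε s :=
  (hf.comp_sub_left x).mul_bdd (c := ε⁻¹)
    (continuous_conjPoissonKernel hε).aestronglyMeasurable
    (Eventually.of_forall fun _ => abs_conjPoissonKernel_le hε _)

theorem conjPoisson_eq_integral_Ioi {ε : ℝ} (hε : 0 < ε) {f : ℝ → ℝ} (hf : Integrable f) (x : ℝ) :
    conjPoisson ε f x =
      ∫ s in Ioi (0 : ℝ), (f (x - s) - f (x + s)) * conjPoissonKernel ε s := by
  rw [conjPoisson_eq,
    integral_eq_integral_Ioi_add_neg (integrable_comp_sub_mul_conjPoissonKernel hε hf x)]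
  refine integral_congr_ae (Eventually.of_forall fun s => ?_)
  dsimp only
  rw [conjPoissonKernel_neg, sub_neg_eq_add]
  ring

namespace IsW1Pair

variable {F g : ℝ → ℝ} {ε : ℝ}

theorem integrable_conjPoisson_integrand (hε : 0 < ε) (hg : Integrable g) (x y : ℝ) :
    Integrable (Function.uncurry fun t s => g (t - s) * conjPoissonKernel ε s)
      ((volume.restrict (uIoc x y)).prod volume) := by
  have hm : AEStronglyMeasurable (Function.uncurry fun t s => g (t - s) * conjPoissonKernel ε s)
      ((volume.restrict (uIoc x y)).prod volume) := by
    have h1 := AEStronglyMeasurable.convolution_integrand (ContinuousLinearMap.mul ℝ ℝ)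
      (μ := volume) (ν := volume) (continuous_conjPoissonKernel hε).aestronglyMeasurable hg.1
    have h2 := h1.mono_ac ((Measure.absolutelyContinuous_of_le
      (Measure.restrict_le_self (s := uIoc x y))).prod (Measure.AbsolutelyContinuous.refl volume))
    refine h2.congr (Eventually.of_forall fun p => ?_)
    simp [Function.uncurry, mul_comm]
  rw [integrable_prod_iff hm]
  refine ⟨Eventually.of_forall fun t => integrable_comp_sub_mul_conjPoissonKernel hε hg t, ?_⟩
  refine Integrable.mono' (g := fun _ => (∫ s, |g s|) * ε⁻¹)
    (integrable_const_iff.2 (Or.inr ?_)) hm.norm.integral_prod_right'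
    (Eventually.of_forall fun t => ?_)
  · rw [isFiniteMeasure_restrict, uIoc]
    exact measure_Ioc_lt_top.ne
  · rw [Real.norm_eq_abs, abs_of_nonneg (integral_nonneg fun _ => norm_nonneg _),
      ← integral_sub_left_eq_self (fun s => |g s|) volume t, ← integral_mul_const]
    refine integral_mono (integrable_comp_sub_mul_conjPoissonKernel hε hg t).norm
      ((hg.comp_sub_left t).abs.mul_const _) fun s => ?_
    simp only [Function.uncurry, Real.norm_eq_abs, abs_mul]
    exact mul_le_mul_of_nonneg_left (abs_conjPoissonKernel_le hε s) (abs_nonneg _)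

/-- Convolution commutes with differentiation, by Fubini on a bounded interval times the line. This
transfers the `L²` bound to derivatives. -/
theorem conjPoisson_isPrimitive (h : IsW1Pair F g) (hε : 0 < ε) :
    IsPrimitive (conjPoisson ε F) (conjPoisson ε g) := by
  intro x y
  have e : (fun t => conjPoisson ε g t) = fun t => ∫ s, g (t - s) * conjPoissonKernel ε s :=
    funext fun t => conjPoisson_eq ε g t
  rw [show ∫ t in x..y, conjPoisson ε g t = ∫ t in x..y, ∫ s, g (t - s) * conjPoissonKernel ε s by
    rw [← e], intervalIntegral_integral_swap
      (integrable_conjPoisson_integrand hε h.integrable_deriv x y), conjPoisson_eq, conjPoisson_eq,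
    ← integral_sub (integrable_comp_sub_mul_conjPoissonKernel hε h.integrable y)
      (integrable_comp_sub_mul_conjPoissonKernel hε h.integrable x)]
  refine integral_congr_ae (Eventually.of_forall fun s => ?_)
  dsimp only
  rw [intervalIntegral.integral_mul_const, intervalIntegral.integral_comp_sub_right,
    ← h.isPrimitive]
  ring

theorem conjPoisson_isH1Pair (h : IsW1Pair F g) (hε : 0 < ε) :
    IsH1Pair (fun x => Real.pi⁻¹ * conjPoisson ε F x)
      (fun x => Real.pi⁻¹ * conjPoisson ε g x) where
  memLp := (memLp_conjPoisson hε h.integrable).const_mul _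
  memLp_deriv := (memLp_conjPoisson hε h.integrable_deriv).const_mul _
  isPrimitive := fun x y => by
    rw [intervalIntegral.integral_const_mul, ← h.conjPoisson_isPrimitive hε]
    ring

theorem norm_conjPoisson_le (h : IsW1Pair F g) (hε : 0 < ε) :
    ‖(h.conjPoisson_isH1Pair hε).toH1‖ ≤ ‖h.toH1‖ := by
  refine (sq_le_sq₀ (norm_nonneg _) (norm_nonneg _)).1 ?_
  rw [IsH1Pair.norm_toH1_sq, IsH1Pair.norm_toH1_sq]
  have h1 := integral_conjPoisson_sq_le hε h.integrable h.memLp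
  have h2 := integral_conjPoisson_sq_le hε h.integrable_deriv h.memLp_deriv
  simp only [mul_pow]
  rw [integral_const_mul, integral_const_mul, inv_pow]
  have hpi : 0 < Real.pi ^ 2 := by positivity
  gcongr ?_ + ?_ <;> rwa [inv_mul_le_iff₀ hpi]

/-- A function dominating the integrand of the Hilbert transform. -/
theorem abs_diff_mul_inv_le (h : IsH1Pair F g) (x : ℝ) {s : ℝ} (hs : 0 < s) :
    |F (x - s) - F (x + s)| * s⁻¹ ≤
      (Ioc (0 : ℝ) 1).indicator (fun s => 2 * Real.sqrt (∫ t, g t ^ 2) * s ^ (-(1 / 2) : ℝ)) s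
        + (|F (x - s)| + |F (x + s)|) := by
  -- Near `0` the Hölder-1/2 estimate leaves the integrable singularity `s^(-1/2)`; away from it
  -- `s⁻¹ ≤ 1` and integrability of `F` suffices.
  by_cases h1 : s ≤ 1
  · rw [indicator_of_mem (show s ∈ Ioc (0 : ℝ) 1 from ⟨hs, h1⟩)]
    have h2 := h.abs_sub_le (x + s) (x - s)
    have h3 : Real.sqrt |x - s - (x + s)| ≤ 2 * Real.sqrt s := by
      rw [show x - s - (x + s) = -(2 * s) by ring, abs_neg, abs_of_pos (by positivity),
        Real.sqrt_le_left (by positivity), mul_pow, Real.sq_sqrt hs.le]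
      linarith
    have h4 : s ^ (-(1 / 2) : ℝ) = Real.sqrt s * s⁻¹ := by
      rw [Real.sqrt_eq_rpow, ← Real.rpow_neg_one s, ← Real.rpow_add hs]
      norm_num
    rw [h4]
    have h5 : |F (x - s) - F (x + s)| * s⁻¹ ≤
        2 * Real.sqrt s * Real.sqrt (∫ t, g t ^ 2) * s⁻¹ := by
      gcongr
      exact h2.trans (mul_le_mul_of_nonneg_right h3 (Real.sqrt_nonneg _))
    have h6 : 0 ≤ |F (x - s)| + |F (x + s)| := by positivity
    linarith
  · rw [indicator_of_notMem (fun h' => h1 h'.2), zero_add]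
    have h2 : s⁻¹ ≤ 1 := inv_le_one_of_one_le₀ (not_le.1 h1).le
    exact (mul_le_of_le_one_right (abs_nonneg _) h2).trans (abs_sub _ _)

theorem integrable_dominating (h : IsW1Pair F g) (x : ℝ) :
    Integrable (fun s => (Ioc (0 : ℝ) 1).indicator
        (fun s => 2 * Real.sqrt (∫ t, g t ^ 2) * s ^ (-(1 / 2) : ℝ)) s
        + (|F (x - s)| + |F (x + s)|)) := by
  refine Integrable.add ?_ ((h.integrable.comp_sub_left x).abs.add (h.integrable.comp_add_left x).abs)
  rw [integrable_indicator_iff measurableSet_Ioc]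
  refine Integrable.const_mul ?_ _
  have := intervalIntegral.intervalIntegrable_rpow' (a := 0) (b := 1) (r := -(1 / 2)) (by norm_num)
  rwa [intervalIntegrable_iff_integrableOn_Ioc_of_le zero_le_one] at this

theorem integrableOn_diff_mul (h : IsW1Pair F g) (x : ℝ) {k : ℝ → ℝ}
    (hk : Measurable k) (hk' : ∀ s, 0 < s → |k s| ≤ s⁻¹) :
    IntegrableOn (fun s => (F (x - s) - F (x + s)) * k s) (Ioi 0) := by
  have hc := h.continuous
  refine (h.integrable_dominating x).integrableOn.mono'
    ((by fun_prop : Continuous fun s => F (x - s) - F (x + s)).measurable.mul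
      hk).aestronglyMeasurable ?_
  filter_upwards [ae_restrict_mem measurableSet_Ioi] with s hs
  rw [Real.norm_eq_abs, abs_mul]
  exact (mul_le_mul_of_nonneg_left (hk' s hs) (abs_nonneg _)).trans
    (abs_diff_mul_inv_le h.toIsH1Pair x hs)

theorem integrableOn_diff_mul_inv (h : IsW1Pair F g) (x : ℝ) :
    IntegrableOn (fun s => (F (x - s) - F (x + s)) * s⁻¹) (Ioi 0) :=
  h.integrableOn_diff_mul x measurable_inv fun _ hs => (abs_of_pos (inv_pos.2 hs)).le

/-- The integral of the dominating function does not depend on `x`, by translation invariance. The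
uniformity is needed for Fubini in `integral_mul_hilb`. -/
theorem exists_integral_abs_le (h : IsW1Pair F g) :
    ∃ K : ℝ, ∀ x, ∫ s in Ioi (0 : ℝ), |(F (x - s) - F (x + s)) * s⁻¹| ≤ K := by
  refine ⟨(∫ s, (Ioc (0 : ℝ) 1).indicator
        (fun s => 2 * Real.sqrt (∫ t, g t ^ 2) * s ^ (-(1 / 2) : ℝ)) s) + ((∫ t, |F t|) + ∫ t, |F t|),
      fun x => ?_⟩
  have hd := h.integrable_dominating x
  have h1 : ∫ s in Ioi (0 : ℝ), |(F (x - s) - F (x + s)) * s⁻¹| ≤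
      ∫ s in Ioi (0 : ℝ), ((Ioc (0 : ℝ) 1).indicator
        (fun s => 2 * Real.sqrt (∫ t, g t ^ 2) * s ^ (-(1 / 2) : ℝ)) s
        + (|F (x - s)| + |F (x + s)|)) := by
    refine setIntegral_mono_on (h.integrableOn_diff_mul_inv x).abs hd.integrableOn
      measurableSet_Ioi fun s hs => ?_
    rw [abs_mul, abs_of_pos (inv_pos.2 (mem_Ioi.1 hs))]
    exact abs_diff_mul_inv_le h.toIsH1Pair x hs
  have hF1 := (h.integrable.comp_sub_left x).abs
  have hF2 := (h.integrable.comp_add_left x).abs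
  have hi : Integrable ((Ioc (0 : ℝ) 1).indicator
        (fun s => 2 * Real.sqrt (∫ t, g t ^ 2) * s ^ (-(1 / 2) : ℝ))) := by
    refine (hd.sub (hF1.add hF2)).congr (Eventually.of_forall fun s => ?_)
    simp
  have h2 := setIntegral_le_integral (s := Ioi (0 : ℝ)) hd (Eventually.of_forall fun s => by
    refine add_nonneg (indicator_nonneg (fun t ht => ?_) s) (by positivity)
    have := ht.1
    positivity)
  have hF12 : Integrable fun s => |F (x - s)| + |F (x + s)| := hF1.add hF2
  rw [integral_add hi hF12, integral_add hF1 hF2,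
    integral_sub_left_eq_self (fun s => |F s|) volume x,
    integral_add_left_eq_self (fun s => |F s|) x] at h2
  exact h1.trans h2

theorem tendsto_conjPoisson (h : IsW1Pair F g) (x : ℝ) :
    Tendsto (fun ε => Real.pi⁻¹ * conjPoisson ε F x) (𝓝[>] 0) (𝓝 (hilb F x)) := by
  refine Tendsto.const_mul _ ?_
  have h1 : Tendsto (fun ε => ∫ s in Ioi (0 : ℝ), (F (x - s) - F (x + s)) * conjPoissonKernel ε s)
      (𝓝[>] 0) (𝓝 (∫ s in Ioi (0 : ℝ), (F (x - s) - F (x + s)) * s⁻¹)) := by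
    refine tendsto_integral_filter_of_dominated_convergence
      (fun s => |(F (x - s) - F (x + s)) * s⁻¹|) ?_ ?_ (h.integrableOn_diff_mul_inv x).abs ?_
    · filter_upwards [self_mem_nhdsWithin] with ε hε
      exact (h.integrableOn_diff_mul x (continuous_conjPoissonKernel hε).measurable
        fun s hs => abs_conjPoissonKernel_le_inv hs).aestronglyMeasurable
    · refine Eventually.of_forall fun ε => ?_
      filter_upwards [ae_restrict_mem measurableSet_Ioi] with s hs
      rw [Real.norm_eq_abs, abs_mul, abs_mul, abs_of_pos (inv_pos.2 (mem_Ioi.1 hs))]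
      exact mul_le_mul_of_nonneg_left (abs_conjPoissonKernel_le_inv hs) (abs_nonneg _)
    · filter_upwards [ae_restrict_mem measurableSet_Ioi] with s hs
      refine Tendsto.const_mul _ (Tendsto.mono_left ?_ nhdsWithin_le_nhds)
      have hs' : s ≠ 0 := (mem_Ioi.1 hs).ne'
      have hc : ContinuousAt (fun ε => conjPoissonKernel ε s) 0 := by
        unfold conjPoissonKernel
        exact ContinuousAt.div (by fun_prop) (by fun_prop) (by simpa using hs')
      have := hc.tendsto
      have e : conjPoissonKernel 0 s = s⁻¹ := by
        unfold conjPoissonKernel; field_simp; simp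
      rwa [e] at this
  refine h1.congr' ?_
  filter_upwards [self_mem_nhdsWithin] with ε hε
  rw [conjPoisson_eq_integral_Ioi hε h.integrable]

/-- The conjugate Poisson integrals at heights `1/(n+1)` are bounded in `H¹` and converge pointwise
to `hilb F`, so weak compactness applies. -/
theorem exists_rep_eq_hilb (h : IsW1Pair F g) :
    ∃ r : H1, r.rep = hilb F ∧ ‖r‖ ≤ ‖h.toH1‖ := by
  have hp : ∀ n : ℕ, (0 : ℝ) < 1 / ((n : ℝ) + 1) := fun n => Nat.one_div_pos_of_nat
  obtain ⟨r, h1, h2⟩ := H1.exists_of_tendsto_of_bounded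
    (fun n => (h.conjPoisson_isH1Pair (hp n)).toH1) _ (fun n => h.norm_conjPoisson_le (hp n))
    (hilb F) fun x => by
      simp only [IsH1Pair.rep_toH1]
      exact (h.tendsto_conjPoisson x).comp (tendsto_nhdsWithin_iff.2
        ⟨tendsto_one_div_add_atTop_nhds_zero_nat, Eventually.of_forall hp⟩)
  exact ⟨r, h2, h1⟩

/-- The truncation is symmetric about `x`, so folding it onto the half line produces the difference
`F(x - s) - F(x + s)`, and dominated convergence removes the cutoff. -/
theorem hasHilbertTransformAt (h : IsW1Pair F g) (x : ℝ) :
    HasHilbertTransformAt F x (hilb F x) := by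
  unfold HasHilbertTransformAt hilb
  rw [one_div]
  refine Tendsto.const_mul _ ?_
  have hI := h.integrableOn_diff_mul_inv x
  have h1 : Tendsto (fun ε => ∫ s in Ioi (0 : ℝ),
      (Ioi ε).indicator (fun s => (F (x - s) - F (x + s)) * s⁻¹) s)
      (𝓝[>] 0) (𝓝 (∫ s in Ioi (0 : ℝ), (F (x - s) - F (x + s)) * s⁻¹)) := by
    refine tendsto_integral_filter_of_dominated_convergence
      (fun s => |(F (x - s) - F (x + s)) * s⁻¹|) ?_ ?_ hI.abs ?_
    · exact Eventually.of_forall fun ε => hI.aestronglyMeasurable.indicator measurableSet_Ioi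
    · exact Eventually.of_forall fun ε => Eventually.of_forall fun s =>
        norm_indicator_le_norm_self _ _
    · filter_upwards [ae_restrict_mem measurableSet_Ioi] with s hs
      refine tendsto_const_nhds.congr' ?_
      have : ∀ᶠ ε in 𝓝[>] (0 : ℝ), ε < s := nhdsWithin_le_nhds (Iio_mem_nhds hs)
      filter_upwards [this] with ε hε
      rw [indicator_of_mem (mem_Ioi.2 hε)]
  refine h1.congr' ?_
  filter_upwards [self_mem_nhdsWithin] with ε hε
  have hε0 : (0 : ℝ) < ε := hε
  have hms : MeasurableSet {s : ℝ | ε < |s|} := measurableSet_lt measurable_const (by fun_prop)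
  have hmy : MeasurableSet {y : ℝ | ε < |x - y|} := measurableSet_lt measurable_const (by fun_prop)
  have hint : Integrable ({s : ℝ | ε < |s|}.indicator fun s => F (x - s) * s⁻¹) := by
    refine ((h.integrable.comp_sub_left x).mul_const ε⁻¹).norm.mono'
      ((((h.continuous.comp (continuous_const.sub continuous_id)).measurable.mul
        measurable_inv).indicator hms).aestronglyMeasurable) (Eventually.of_forall fun s => ?_)
    by_cases hs : ε < |s|
    · rw [indicator_of_mem (show s ∈ {s : ℝ | ε < |s|} from hs), norm_mul, norm_mul, norm_inv,
        norm_inv, Real.norm_eq_abs ε, abs_of_pos hε0]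
      gcongr
      exact hs.le
    · rw [indicator_of_notMem (show s ∉ {s : ℝ | ε < |s|} from hs), norm_zero]
      positivity
  rw [← integral_indicator hmy, ← integral_sub_left_eq_self _ volume x]
  have e1 : ∀ s, ({y : ℝ | ε < |x - y|}.indicator (fun y => F y / (x - y))) (x - s) =
      ({s : ℝ | ε < |s|}.indicator fun s => F (x - s) * s⁻¹) s := fun s => by
    simp only [indicator, mem_ofPred_eq, sub_sub_cancel, div_eq_mul_inv]
  simp only [e1]
  rw [integral_eq_integral_Ioi_add_neg hint]
  refine setIntegral_congr_fun measurableSet_Ioi fun s hs => ?_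
  have hs0 : 0 < s := hs
  simp only [indicator, mem_ofPred_eq, mem_Ioi, abs_neg, abs_of_pos hs0, sub_neg_eq_add, inv_neg]
  split_ifs
  · ring
  · ring

theorem hilb_add {G k : ℝ → ℝ} (h : IsW1Pair F g) (h' : IsW1Pair G k) :
    hilb (fun x => F x + G x) = hilb F + hilb G := by
  funext x
  simp only [hilb, Pi.add_apply]
  rw [← mul_add, ← integral_add (h.integrableOn_diff_mul_inv x) (h'.integrableOn_diff_mul_inv x)]
  congr 2
  funext s
  ring

end IsW1Pair

theorem hilb_smul (c : ℝ) (F : ℝ → ℝ) : hilb (fun x => c * F x) = c • hilb F := by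
  funext x
  simp only [hilb, Pi.smul_apply, smul_eq_mul]
  rw [mul_left_comm]
  congr 1
  rw [← integral_const_mul]
  congr 1
  funext s
  ring

/-- The bilinear map `(p, q) ↦ H(p q)` on `H¹(ℝ)`. -/
noncomputable def H1.hilbMulL : H1 →L[ℝ] H1 →L[ℝ] H1 :=
  H1.bilinOfRep (fun p q => hilb fun x => p.rep x * q.rep x)
    (fun p p' q => by
      rw [← (p.isW1Pair_mul q).hilb_add (p'.isW1Pair_mul q)]
      simp [H1.rep_add, add_mul])
    (fun c p q => by
      rw [← hilb_smul]
      simp [H1.rep_smul, mul_assoc])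
    (fun p q q' => by
      rw [← (p.isW1Pair_mul q).hilb_add (p.isW1Pair_mul q')]
      simp [H1.rep_add, mul_add])
    (fun c p q => by
      rw [← hilb_smul]
      simp [H1.rep_smul, mul_left_comm]) 5
    (fun p q => by
      obtain ⟨r, h1, h2⟩ := (p.isW1Pair_mul q).exists_rep_eq_hilb
      exact ⟨r, h1, h2.trans (H1.norm_mul_le p q)⟩)

@[simp] theorem H1.rep_hilbMulL (p q : H1) :
    (H1.hilbMulL p q).rep = hilb fun x => p.rep x * q.rep x :=
  H1.rep_bilinOfRep (b := fun p q => hilb fun x => p.rep x * q.rep x) p q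

/-! ### The moment identity for the Hilbert transform. -/

/-- Swap the integrals so that `s` is outermost. Shifting `x` by `s` in the second half makes the
weights differ by `(x - a) - (x - s - a) = s`, which cancels `s⁻¹` and leaves the autocorrelation of
`F` at `s`. That is even in `s` with integral `(∫ F)²` over the line, so the half line carries half
of it. -/
theorem IsW1Pair.integral_mul_hilb {F g : ℝ → ℝ} (h : IsW1Pair F g) (a : ℝ)
    (hψ : Integrable fun x => (x - a) * F x) :
    ∫ x, (x - a) * F x * hilb F x = (2 * Real.pi)⁻¹ * (∫ x, F x) ^ 2 := by
  have hc := h.continuous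
  obtain ⟨K, hK⟩ := h.exists_integral_abs_le
  have hm : AEStronglyMeasurable (fun p : ℝ × ℝ => (p.1 - a) * F p.1 *
      ((F (p.1 - p.2) - F (p.1 + p.2)) * p.2⁻¹)) (volume.prod (volume.restrict (Ioi 0))) :=
    ((by fun_prop : Continuous fun p : ℝ × ℝ => (p.1 - a) * F p.1).measurable.mul
      ((by fun_prop : Continuous fun p : ℝ × ℝ => F (p.1 - p.2) - F (p.1 + p.2)).measurable.mul
        measurable_snd.inv)).aestronglyMeasurable
  have hI : Integrable (fun p : ℝ × ℝ => (p.1 - a) * F p.1 *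
      ((F (p.1 - p.2) - F (p.1 + p.2)) * p.2⁻¹)) (volume.prod (volume.restrict (Ioi 0))) := by
    rw [integrable_prod_iff hm]
    refine ⟨Eventually.of_forall fun x => (h.integrableOn_diff_mul_inv x).const_mul ((x - a) * F x), ?_⟩
    refine (hψ.norm.mul_const K).mono' hm.norm.integral_prod_right'
      (Eventually.of_forall fun x => ?_)
    rw [Real.norm_eq_abs, abs_of_nonneg (integral_nonneg fun _ => norm_nonneg _)]
    simp only [norm_mul ((x - a) * F x)]
    rw [integral_const_mul]
    exact mul_le_mul_of_nonneg_left (hK x) (norm_nonneg _)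
  have hR : Integrable (fun p : ℝ × ℝ => F p.2 * F (p.2 - p.1)) (volume.prod volume) := by
    have := h.integrable.convolution_integrand (ContinuousLinearMap.mul ℝ ℝ) (μ := volume)
      h.integrable.comp_neg
    refine this.congr (Eventually.of_forall fun p => ?_)
    simp
  have hb : ∀ x, ‖F x‖ ≤ Real.sqrt (∫ t, F t ^ 2) + Real.sqrt (∫ t, g t ^ 2) := h.abs_le
  have i1 : ∀ s, Integrable fun x => (x - a) * F x * F (x - s) := fun s =>
    hψ.mul_bdd (hc.comp (continuous_id.sub continuous_const)).aestronglyMeasurable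
      (Eventually.of_forall fun x => hb _)
  have i2 : ∀ s, Integrable fun x => (x - a) * F x * F (x + s) := fun s =>
    hψ.mul_bdd (hc.comp (continuous_id.add continuous_const)).aestronglyMeasurable
      (Eventually.of_forall fun x => hb _)
  have inner : ∀ s ∈ Ioi (0 : ℝ), ∫ x, (x - a) * F x * ((F (x - s) - F (x + s)) * s⁻¹) =
      ∫ x, F x * F (x - s) := by
    intro s hs
    have hs0 : s ≠ 0 := (mem_Ioi.1 hs).ne'
    have e1 : ∫ x, (x - a) * F x * ((F (x - s) - F (x + s)) * s⁻¹) =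
        s⁻¹ * ((∫ x, (x - a) * F x * F (x - s)) - ∫ x, (x - a) * F x * F (x + s)) := by
      rw [← integral_sub (i1 s) (i2 s), ← integral_const_mul]
      congr 1; funext x; ring
    have e2 : ∫ x, (x - a) * F x * F (x + s) = ∫ x, (x - s - a) * F (x - s) * F (x - s + s) :=
      (integral_sub_right_eq_self (fun x => (x - a) * F x * F (x + s)) s).symm
    have i3 : Integrable fun x => (x - s - a) * F (x - s) * F (x - s + s) :=
      (i2 s).comp_sub_right s
    rw [e1, e2, ← integral_sub (i1 s) i3, ← integral_const_mul]
    congr 1; funext x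
    rw [sub_add_cancel]
    field_simp
    ring
  have heven : ∀ s, ∫ x, F x * F (x - -s) = ∫ x, F x * F (x - s) := fun s => by
    rw [← integral_sub_right_eq_self (fun x => F x * F (x - -s)) s]
    congr 1; funext x
    rw [sub_neg_eq_add, sub_add_cancel, mul_comm]
  have hsq : ∫ s, ∫ x, F x * F (x - s) = (∫ x, F x) ^ 2 := by
    rw [integral_integral_swap (f := fun s x => F x * F (x - s)) hR]
    simp only [integral_const_mul]
    simp only [integral_sub_left_eq_self F volume]
    rw [integral_mul_const, pow_two]
  rw [integral_eq_integral_Ioi_add_neg hR.integral_prod_left] at hsq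
  simp only [heven, ← two_mul] at hsq
  rw [integral_const_mul] at hsq
  have e3 : ∫ x, (x - a) * F x * hilb F x = Real.pi⁻¹ * ∫ x, ∫ s in Ioi (0 : ℝ),
      (x - a) * F x * ((F (x - s) - F (x + s)) * s⁻¹) := by
    rw [← integral_const_mul]
    congr 1; funext x
    rw [integral_const_mul]
    unfold hilb
    ring
  rw [e3, integral_integral_swap hI, setIntegral_congr_fun measurableSet_Ioi inner, ← hsq]
  have := Real.pi_pos
  field_simp

/-! ### Maximal solutions of an ODE with a locally Lipschitz field. -/

section MaximalSolution

variable {E : Type*} [NormedAddCommGroup E] [NormedSpace ℝ E]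

/-- `w` solves `w' = N(w)` on `[0, T)` with initial value `w₀`. -/
structure IsForwardSolution (N : E → E) (w₀ : E) (T : ℝ) (w : ℝ → E) : Prop where
  pos : 0 < T
  initial : w 0 = w₀
  hasDerivWithinAt : ∀ t ∈ Ico 0 T, HasDerivWithinAt w (N (w t)) (Ico 0 T) t

/-- `N` is Lipschitz on every ball centred at the origin. -/
def LipschitzOnBalls (N : E → E) : Prop :=
  ∀ M : ℝ, ∃ K : NNReal, LipschitzOnWith K N (Metric.closedBall 0 M)

variable {N : E → E} {w₀ : E} {T T' : ℝ} {w w' : ℝ → E}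

theorem IsForwardSolution.continuousOn (h : IsForwardSolution N w₀ T w) :
    ContinuousOn w (Ico 0 T) := fun t ht => (h.hasDerivWithinAt t ht).continuousWithinAt

theorem IsForwardSolution.hasDerivWithinAt_Ici (h : IsForwardSolution N w₀ T w) {t : ℝ}
    (ht : t ∈ Ico 0 T) : HasDerivWithinAt w (N (w t)) (Ici t) t :=
  (h.hasDerivWithinAt t ht).mono_of_mem_nhdsWithin
    (mem_of_superset (Ico_mem_nhdsGE ht.2) (Ico_subset_Ico_left ht.1))

theorem IsForwardSolution.eq_of_mem (hN : LipschitzOnBalls N) (h : IsForwardSolution N w₀ T w)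
    (h' : IsForwardSolution N w₀ T' w') {t : ℝ} (h0 : 0 ≤ t) (hT : t < T) (hT' : t < T') :
    w t = w' t := by
  have c : ContinuousOn w (Icc 0 t) := h.continuousOn.mono (Icc_subset_Ico_right hT)
  have c' : ContinuousOn w' (Icc 0 t) := h'.continuousOn.mono (Icc_subset_Ico_right hT')
  obtain ⟨M, hM⟩ := isCompact_Icc.exists_bound_of_continuousOn c
  obtain ⟨M', hM'⟩ := isCompact_Icc.exists_bound_of_continuousOn c'
  obtain ⟨K, hK⟩ := hN (max M M')
  refine ODE_solution_unique_of_mem_Icc_right (v := fun _ => N) (K := K)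
    (s := fun _ => Metric.closedBall 0 (max M M')) (fun _ _ => hK) c
    (fun s hs => h.hasDerivWithinAt_Ici ⟨hs.1, hs.2.trans hT⟩)
    (fun s hs => ?_) c' (fun s hs => h'.hasDerivWithinAt_Ici ⟨hs.1, hs.2.trans hT'⟩)
    (fun s hs => ?_) (h.initial.trans h'.initial.symm) ⟨h0, le_rfl⟩
  · exact mem_closedBall_zero_iff.2 ((hM s (Ico_subset_Icc_self hs)).trans (le_max_left _ _))
  · exact mem_closedBall_zero_iff.2 ((hM' s (Ico_subset_Icc_self hs)).trans (le_max_right _ _))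

/-- The point is that `τ` depends on `M` alone, not on the initial point or time. On the ball of
radius `|M| + 1` the field is bounded by `L`, so a solution of duration `1/(L + 1)` moves by at most
one. -/
theorem LipschitzOnBalls.exists_local_solution [CompleteSpace E] (hN : LipschitzOnBalls N)
    (M : ℝ) : ∃ τ : ℝ, 0 < τ ∧ ∀ (x : E) (t₀ : ℝ), ‖x‖ ≤ M → ∃ α : ℝ → E, α t₀ = x ∧
      ∀ t ∈ Icc t₀ (t₀ + τ), HasDerivWithinAt α (N (α t)) (Icc t₀ (t₀ + τ)) t := by
  obtain ⟨K, hK⟩ := hN (|M| + 1)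
  set L : NNReal := ‖N 0‖₊ + K * (‖M‖₊ + 1) with hL
  have hτ : (0 : ℝ) < 1 / (L + 1) := by positivity
  refine ⟨1 / (L + 1), hτ, fun x t₀ hx => ?_⟩
  have hsub : Metric.closedBall x (1 : NNReal) ⊆ Metric.closedBall 0 (|M| + 1) := fun y hy => by
    rw [mem_closedBall_zero_iff]
    have h1 : ‖y - x‖ ≤ 1 := by
      rw [← dist_eq_norm]
      exact hy
    have h2 := norm_add_le (y - x) x
    rw [sub_add_cancel] at h2
    linarith [le_abs_self M]
  have hpl : IsPicardLindelof (fun _ => N) (tmin := t₀) (tmax := t₀ + 1 / (L + 1))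
      ⟨t₀, by simp; positivity⟩ x 1 0 L K :=
    { lipschitzOnWith := fun _ _ => hK.mono hsub
      continuousOn := fun _ _ => continuousOn_const
      norm_le := fun _ _ y hy => by
        have h0 : (0 : E) ∈ Metric.closedBall 0 (|M| + 1) := by simp; positivity
        have h1 := hK.norm_sub_le (hsub hy) h0
        rw [sub_zero] at h1
        have h2 := mem_closedBall_zero_iff.1 (hsub hy)
        have h3 := norm_add_le (N y - N 0) (N 0)
        rw [sub_add_cancel] at h3
        have h4 : (K : ℝ) * ‖y‖ ≤ K * (|M| + 1) := by gcongr
        simp only [hL, NNReal.coe_add, NNReal.coe_mul, coe_nnnorm, NNReal.coe_one,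
          Real.norm_eq_abs]
        linarith
      mul_max_le := by
        simp only [add_sub_cancel_left, sub_self, NNReal.coe_one, NNReal.coe_zero, sub_zero]
        rw [max_eq_left hτ.le, mul_one_div, div_le_one (by positivity)]
        linarith }
  obtain ⟨α, h1, h2⟩ := hpl.exists_eq_forall_mem_Icc_hasDerivWithinAt₀
  exact ⟨α, h1, h2⟩

theorem IsForwardSolution.extend (h : IsForwardSolution N w₀ T w) {t₀ τ : ℝ} (ht₀ : t₀ ∈ Ico 0 T)
    (hτ : 0 < τ) {α : ℝ → E} (hα₀ : α t₀ = w t₀)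
    (hα : ∀ t ∈ Icc t₀ (t₀ + τ), HasDerivWithinAt α (N (α t)) (Icc t₀ (t₀ + τ)) t) :
    ∃ w', IsForwardSolution N w₀ (t₀ + τ) w' := by
  classical
  set β : ℝ → E := fun t => if t ≤ t₀ then w t else α t with hβ
  have b1 : ∀ t, t ≤ t₀ → β t = w t := fun t ht => if_pos ht
  have b2 : ∀ t, t₀ ≤ t → β t = α t := fun t ht => by
    rcases ht.eq_or_lt with rfl | h'
    · rw [b1 _ le_rfl, hα₀]
    · exact if_neg (not_le.2 h')
  have d1 : ∀ t ∈ Icc 0 t₀, HasDerivWithinAt β (N (β t)) (Icc 0 t₀) t := fun t ht => by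
    rw [b1 t ht.2]
    exact ((h.hasDerivWithinAt t ⟨ht.1, ht.2.trans_lt ht₀.2⟩).mono
      (Icc_subset_Ico_right ht₀.2)).congr (fun s hs => b1 s hs.2) (b1 t ht.2)
  have d2 : ∀ t ∈ Icc t₀ (t₀ + τ), HasDerivWithinAt β (N (β t)) (Icc t₀ (t₀ + τ)) t :=
    fun t ht => by
      rw [b2 t ht.1]
      exact (hα t ht).congr (fun s hs => b2 s hs.1) (b2 t ht.1)
  refine ⟨β, by linarith [ht₀.1], (b1 0 ht₀.1).trans h.initial, fun t ht => ?_⟩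
  rcases lt_trichotomy t t₀ with hlt | rfl | hgt
  · refine (d1 t ⟨ht.1, hlt.le⟩).mono_of_mem_nhdsWithin ?_
    filter_upwards [self_mem_nhdsWithin, nhdsWithin_le_nhds (Iio_mem_nhds hlt)] with s hs hs'
    exact ⟨hs.1, (mem_Iio.1 hs').le⟩
  -- At the junction both one-sided derivatives are the field at the common value.
  · refine ((d1 t ⟨ht.1, le_rfl⟩).union (d2 t ⟨le_rfl, ht.2.le⟩)).mono fun s hs => ?_
    rcases le_total s t with h1 | h1
    · exact Or.inl ⟨hs.1, h1⟩
    · exact Or.inr ⟨h1, hs.2.le⟩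
  · refine (d2 t ⟨hgt.le, ht.2.le⟩).mono_of_mem_nhdsWithin ?_
    filter_upwards [self_mem_nhdsWithin, nhdsWithin_le_nhds (Ioi_mem_nhds hgt)] with s hs hs'
    exact ⟨(mem_Ioi.1 hs').le, hs.2.le⟩

theorem LipschitzOnBalls.exists_isForwardSolution [CompleteSpace E] (hN : LipschitzOnBalls N)
    (w₀ : E) : ∃ T w, IsForwardSolution N w₀ T w := by
  obtain ⟨τ, hτ, h⟩ := hN.exists_local_solution ‖w₀‖
  obtain ⟨α, h1, h2⟩ := h w₀ 0 le_rfl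
  rw [zero_add] at h2
  exact ⟨τ, α, hτ, h1, fun t ht => (h2 t (Ico_subset_Icc_self ht)).mono Ico_subset_Icc_self⟩

/-- If the lifespans of the solutions are bounded, there is a unique maximal solution, and it blows
up. -/
theorem LipschitzOnBalls.exists_maximal [CompleteSpace E] (hN : LipschitzOnBalls N) (w₀ : E)
    (B : ℝ) (hB : ∀ T w, IsForwardSolution N w₀ T w → T ≤ B) :
    ∃ T w, T ≤ B ∧ IsForwardSolution N w₀ T w ∧ Tendsto (fun t => ‖w t‖) (𝓝[<] T) atTop ∧
      ∀ T' w', IsForwardSolution N w₀ T' w' → T' ≤ T ∧ ∀ t ∈ Ico 0 T', w' t = w t := by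
  set S : Set ℝ := {T | ∃ w, IsForwardSolution N w₀ T w} with hS
  have hbdd : BddAbove S := ⟨B, fun T ⟨w, hw⟩ => hB T w hw⟩
  obtain ⟨T₁, w₁, h₁⟩ := hN.exists_isForwardSolution w₀
  have hne : S.Nonempty := ⟨T₁, w₁, h₁⟩
  set T := sSup S with hT
  have hTpos : 0 < T := h₁.pos.trans_le (le_csSup hbdd ⟨w₁, h₁⟩)
  have hex : ∀ t : ℝ, ∃ (T' : ℝ) (w' : ℝ → E), t < T → t < T' ∧ IsForwardSolution N w₀ T' w' := by
    intro t
    by_cases ht : t < T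
    · obtain ⟨T', ⟨w', hw'⟩, h'⟩ := exists_lt_of_lt_csSup hne ht
      exact ⟨T', w', fun _ => ⟨h', hw'⟩⟩
    -- A dummy value, so that the choice below is made for every real `t`.
    · exact ⟨0, fun _ => 0, fun h => absurd h ht⟩
  choose τ W hW using hex
  have heq : ∀ T' w', IsForwardSolution N w₀ T' w' → ∀ t ∈ Ico 0 T', w' t = W t t := by
    intro T' w' h' t ht
    have htT : t < T := ht.2.trans_le (le_csSup hbdd ⟨w', h'⟩)
    exact h'.eq_of_mem hN (hW t htT).2 ht.1 ht.2 (hW t htT).1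
  have hsol : IsForwardSolution N w₀ T (fun t => W t t) := by
    refine ⟨hTpos, (hW 0 hTpos).2.initial, fun t ht => ?_⟩
    obtain ⟨h1, h2⟩ := hW t ht.2
    have hd := (h2.hasDerivWithinAt t ⟨ht.1, h1⟩).congr
      (fun s hs => (heq _ _ h2 s hs).symm) rfl
    refine hd.mono_of_mem_nhdsWithin ?_
    filter_upwards [self_mem_nhdsWithin, nhdsWithin_le_nhds (Iio_mem_nhds h1)] with s hs hs'
    exact ⟨hs.1, hs'⟩
  refine ⟨T, fun t => W t t, csSup_le hne fun T ⟨w, hw⟩ => hB T w hw, hsol, ?_,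
    fun T' w' h' => ⟨le_csSup hbdd ⟨w', h'⟩, heq T' w' h'⟩⟩
  rw [tendsto_atTop]
  intro M
  -- Otherwise the norm is below `M` at times arbitrarily close to `T`. Restarting from such a time
  -- within `δ` of `T` gives a solution living beyond the supremum of all lifespans.
  by_contra hcon
  obtain ⟨δ, hδ, hloc⟩ := hN.exists_local_solution M
  have hev : ∀ᶠ t in 𝓝[<] T, t ∈ Ioo (max 0 (T - δ)) T :=
    Ioo_mem_nhdsLT (max_lt hTpos (by linarith))
  obtain ⟨t, ht, ht'⟩ := (not_eventually.1 hcon).and_eventually hev |>.exists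
  obtain ⟨α, hα0, hα⟩ := hloc (W t t) t (not_le.1 ht).le
  obtain ⟨w', hw'⟩ := hsol.extend ⟨(le_max_left _ _).trans ht'.1.le, ht'.2⟩ hδ hα0 hα
  have h1 : t + δ ≤ T := le_csSup hbdd ⟨w', hw'⟩
  have h2 := (le_max_right 0 (T - δ)).trans_lt ht'.1
  linarith

end MaximalSolution

/-! ### The system as an ODE in `H¹ × H¹`. -/

theorem lipschitzOnWith_bilin {X Y Z W : Type*} [NormedAddCommGroup X] [NormedSpace ℝ X]
    [NormedAddCommGroup Y] [NormedSpace ℝ Y] [NormedAddCommGroup Z] [NormedSpace ℝ Z]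
    [NormedAddCommGroup W] [NormedSpace ℝ W] (B : X →L[ℝ] Y →L[ℝ] Z) (f : W →L[ℝ] X)
    (g : W →L[ℝ] Y) (M : ℝ) :
    ∃ K : NNReal, LipschitzOnWith K (fun w => B (f w) (g w)) (Metric.closedBall 0 M) := by
  refine ⟨‖B‖₊ * (‖f‖₊ * ‖g‖₊) * (2 * ‖M‖₊), LipschitzOnWith.of_dist_le_mul fun x hx y hy => ?_⟩
  rw [mem_closedBall_zero_iff] at hx hy
  have hx' := hx.trans (le_abs_self M)
  have hy' := hy.trans (le_abs_self M)
  rw [dist_eq_norm, dist_eq_norm]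
  have e : B (f x) (g x) - B (f y) (g y) = B (f x) (g (x - y)) + B (f (x - y)) (g y) := by
    simp only [map_sub, sub_apply]
    abel
  rw [e]
  have h1 : ‖B (f x) (g (x - y))‖ ≤ ‖B‖ * (‖f‖ * |M|) * (‖g‖ * ‖x - y‖) := by
    refine (B.le_opNorm₂ _ _).trans ?_
    gcongr
    · exact (f.le_opNorm x).trans (by gcongr)
    · exact g.le_opNorm _
  have h2 : ‖B (f (x - y)) (g y)‖ ≤ ‖B‖ * (‖f‖ * ‖x - y‖) * (‖g‖ * |M|) := by
    refine (B.le_opNorm₂ _ _).trans ?_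
    gcongr
    · exact f.le_opNorm _
    · exact (g.le_opNorm y).trans (by gcongr)
  refine (norm_add_le _ _).trans ((add_le_add h1 h2).trans_eq ?_)
  simp only [NNReal.coe_mul, coe_nnnorm, NNReal.coe_ofNat, Real.norm_eq_abs]
  ring

/-- The vector field `(u, v) ↦ (2uv, H(u²))` on `H¹ × H¹`. -/
noncomputable def modelField (w : H1 × H1) : H1 × H1 :=
  ((2 : ℝ) • H1.mulL w.1 w.2, H1.hilbMulL w.1 w.1)

theorem lipschitzOnBalls_modelField : LipschitzOnBalls modelField := by
  intro M
  obtain ⟨K₁, h₁⟩ := lipschitzOnWith_bilin ((2 : ℝ) • H1.mulL) (ContinuousLinearMap.fst ℝ H1 H1)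
    (ContinuousLinearMap.snd ℝ H1 H1) M
  obtain ⟨K₂, h₂⟩ := lipschitzOnWith_bilin H1.hilbMulL (ContinuousLinearMap.fst ℝ H1 H1)
    (ContinuousLinearMap.fst ℝ H1 H1) M
  exact ⟨max K₁ K₂, h₁.prodMk h₂⟩

theorem hasHilbertTransformAt_congr {f g : ℝ → ℝ} (h : f =ᵐ[volume] g) {x l : ℝ}
    (hf : HasHilbertTransformAt f x l) : HasHilbertTransformAt g x l := by
  have : ∀ ε : ℝ, ∫ y in {y : ℝ | ε < |x - y|}, f y / (x - y) =
      ∫ y in {y : ℝ | ε < |x - y|}, g y / (x - y) := fun ε => by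
    refine integral_congr_ae (ae_restrict_of_ae ?_)
    filter_upwards [h] with y hy
    rw [hy]
  unfold HasHilbertTransformAt at hf ⊢
  simpa only [this] using hf

theorem H1.rep_two_smul_mulL (p q : H1) (x : ℝ) :
    ((2 : ℝ) • H1.mulL p q).rep x = 2 * p.rep x * q.rep x := by
  rw [H1.rep_smul, Pi.smul_apply, H1.rep_mulL, smul_eq_mul, mul_assoc]

theorem H1.hasHilbertTransformAt_hilbMulL (p : H1) (x : ℝ) :
    HasHilbertTransformAt (fun y => p.fn y ^ 2) x ((H1.hilbMulL p p).rep x) := by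
  rw [H1.rep_hilbMulL]
  refine hasHilbertTransformAt_congr ?_ ((p.isW1Pair_mul p).hasHilbertTransformAt x)
  filter_upwards [p.rep_ae_eq] with y hy
  rw [hy, pow_two]

theorem IsForwardSolution.isH1Solution {u₀ v₀ : H1} {T : ℝ} {w : ℝ → H1 × H1}
    (h : IsForwardSolution modelField (u₀, v₀) T w) :
    IsH1Solution u₀ v₀ T (fun t => (w t).1) (fun t => (w t).2) := by
  have hu : UniqueDiffOn ℝ (Ico 0 T) := uniqueDiffOn_Ico 0 T
  have h1 : ∀ t ∈ Ico 0 T, HasDerivWithinAt (fun t => (w t).1) ((2 : ℝ) • H1.mulL (w t).1 (w t).2)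
      (Ico 0 T) t := fun t ht => (h.hasDerivWithinAt t ht).fst
  have h2 : ∀ t ∈ Ico 0 T, HasDerivWithinAt (fun t => (w t).2) (H1.hilbMulL (w t).1 (w t).1)
      (Ico 0 T) t := fun t ht => (h.hasDerivWithinAt t ht).snd
  have c1 : ContinuousOn (fun t => (w t).1) (Ico 0 T) := fun t ht => (h1 t ht).continuousWithinAt
  have c2 : ContinuousOn (fun t => (w t).2) (Ico 0 T) := fun t ht => (h2 t ht).continuousWithinAt
  have e1 : ∀ t ∈ Ico 0 T, derivWithin (fun t => (w t).1) (Ico 0 T) t =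
      (2 : ℝ) • H1.mulL (w t).1 (w t).2 := fun t ht => (h1 t ht).derivWithin (hu t ht)
  have e2 : ∀ t ∈ Ico 0 T, derivWithin (fun t => (w t).2) (Ico 0 T) t =
      H1.hilbMulL (w t).1 (w t).1 := fun t ht => (h2 t ht).derivWithin (hu t ht)
  refine ⟨h.pos, congrArg Prod.fst h.initial, congrArg Prod.snd h.initial, ?_, ?_, ?_, ?_⟩
  · rw [contDiffOn_one_iff_derivWithin hu]
    exact ⟨fun t ht => (h1 t ht).differentiableWithinAt, ContinuousOn.congr
      (((H1.mulL.continuous.comp_continuousOn c1).clm_apply c2).const_smul (2 : ℝ)) e1⟩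
  · rw [contDiffOn_one_iff_derivWithin hu]
    exact ⟨fun t ht => (h2 t ht).differentiableWithinAt, ContinuousOn.congr
      ((H1.hilbMulL.continuous.comp_continuousOn c1).clm_apply c1) e2⟩
  · intro t ht
    rw [e1 t ht]
    filter_upwards [((2 : ℝ) • H1.mulL (w t).1 (w t).2).rep_ae_eq, (w t).1.rep_ae_eq,
      (w t).2.rep_ae_eq] with x hx hx1 hx2
    rw [← hx, ← hx1, ← hx2, H1.rep_two_smul_mulL]
  · intro t ht
    rw [e2 t ht]
    filter_upwards [(H1.hilbMulL (w t).1 (w t).1).rep_ae_eq] with x hx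
    rw [← hx]
    exact H1.hasHilbertTransformAt_hilbMulL _ x

/-- Principal values are unique limits and an element of `H1` is determined almost everywhere, so
the pointwise equations force the time derivatives to be the components of `modelField`. -/
theorem IsH1Solution.isForwardSolution {u₀ v₀ : H1} {T : ℝ} {u v : ℝ → H1}
    (h : IsH1Solution u₀ v₀ T u v) :
    IsForwardSolution modelField (u₀, v₀) T (fun t => (u t, v t)) := by
  have hu : UniqueDiffOn ℝ (Ico 0 T) := uniqueDiffOn_Ico 0 T
  refine ⟨h.pos, by rw [h.initial_u, h.initial_v], fun t ht => ?_⟩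
  have d1 := ((contDiffOn_one_iff_derivWithin hu).1 h.contDiffOn_u).1 t ht |>.hasDerivWithinAt
  have d2 := ((contDiffOn_one_iff_derivWithin hu).1 h.contDiffOn_v).1 t ht |>.hasDerivWithinAt
  have e1 : derivWithin u (Ico 0 T) t = (2 : ℝ) • H1.mulL (u t) (v t) := by
    refine H1.ext_rep (H1.rep_eq_of_ae_eq _ (H1.continuous_rep _) ?_)
    filter_upwards [h.eq_u t ht, (u t).rep_ae_eq, (v t).rep_ae_eq] with x hx h1 h2
    rw [hx, H1.rep_two_smul_mulL, h1, h2]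
  have e2 : derivWithin v (Ico 0 T) t = H1.hilbMulL (u t) (u t) := by
    refine H1.ext_rep (H1.rep_eq_of_ae_eq _ (H1.continuous_rep _) ?_)
    filter_upwards [h.eq_v t ht] with x hx
    exact tendsto_nhds_unique hx (H1.hasHilbertTransformAt_hilbMulL _ x)
  rw [e1] at d1
  rw [e2] at d2
  exact d1.prodMk d2

/-! ### The second-order differential inequality. -/

theorem integrableOn_one_div_sqrt_cube_add_one :
    IntegrableOn (fun y : ℝ => 1 / Real.sqrt (|y| ^ 3 + 1)) (Ioi 0) := by
  have h := (integrable_one_add_norm (E := ℝ) (μ := volume) (r := 3 / 2) (by norm_num)).const_mul 2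
  have hc : Continuous fun y : ℝ => 1 / Real.sqrt (|y| ^ 3 + 1) :=
    continuous_const.div₀ (by fun_prop) fun y => by positivity
  refine (h.mono' hc.aestronglyMeasurable (Eventually.of_forall fun y => ?_)).integrableOn
  rw [Real.norm_eq_abs, abs_of_nonneg (by positivity), Real.norm_eq_abs]
  set z := |y| with hz
  have hz0 : 0 ≤ z := abs_nonneg y
  have e : (1 + z) ^ (-(3 / 2) : ℝ) = 1 / Real.sqrt ((1 + z) ^ 3) := by
    rw [Real.sqrt_eq_rpow, ← Real.rpow_natCast, ← Real.rpow_mul (by positivity),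
      Real.rpow_neg (by positivity), one_div]
    norm_num
  -- Convexity of the cube: `(1 + z)³ ≤ 4 (z³ + 1)` for `z ≥ 0`.
  have e2 : Real.sqrt ((1 + z) ^ 3) ≤ 2 * Real.sqrt (z ^ 3 + 1) := by
    rw [Real.sqrt_le_left (by positivity), mul_pow, Real.sq_sqrt (by positivity)]
    nlinarith [mul_nonneg hz0 (sq_nonneg (z - 1)), sq_nonneg (z - 1)]
  rw [e, mul_one_div, div_le_div_iff₀ (by positivity) (by positivity)]
  linarith

/-- A function with `F'' ≥ k F²`, `F(0) ≥ 0` and `F'(0) > 0` has a bounded lifespan. -/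
theorem lifespan_le_of_deriv_deriv_ge {F P Q : ℝ → ℝ} {T k : ℝ} (hk : 0 < k)
    (hF : ∀ t ∈ Ico 0 T, HasDerivWithinAt F (P t) (Ico 0 T) t)
    (hP : ∀ t ∈ Ico 0 T, HasDerivWithinAt P (Q t) (Ico 0 T) t)
    (hQ : ∀ t ∈ Ico 0 T, k * F t ^ 2 ≤ Q t) (hF0 : 0 ≤ F 0) (hP0 : 0 < P 0) :
    T ≤ (2 * k / 3 * P 0) ^ (-(1 / 3) : ℝ) * ∫ y in Ioi (0 : ℝ), 1 / Real.sqrt (y ^ 3 + 1) := by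
  set C := P 0 with hC
  set α := 2 * k / 3 with hα
  have hα0 : 0 < α := by positivity
  -- The time scale for which `y = (F - F 0) / (C μ)` satisfies `μ y' ≥ √(y³ + 1)`; this needs
  -- exactly `μ³ α C = 1`.
  set μ : ℝ := (α * C) ^ (-(1 / 3) : ℝ) with hμ
  have hμ0 : 0 < μ := Real.rpow_pos_of_pos (by positivity) _
  have hμ3 : μ ^ 3 * (α * C) = 1 := by
    rw [hμ, ← Real.rpow_natCast, ← Real.rpow_mul (by positivity)]
    norm_num
    rw [Real.rpow_neg_one, mul_inv_rev]
    field_simp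
  set I := ∫ y in Ioi (0 : ℝ), 1 / Real.sqrt (y ^ 3 + 1) with hI
  have mono : ∀ {f f' : ℝ → ℝ}, (∀ t ∈ Ico 0 T, HasDerivWithinAt f (f' t) (Ico 0 T) t) →
      (∀ t ∈ Ico 0 T, 0 ≤ f' t) → ∀ t ∈ Ico 0 T, f 0 ≤ f t := by
    intro f f' h1 h2 t ht
    have hsub : interior (Ico 0 T) ⊆ Ico 0 T := interior_subset
    exact monotoneOn_of_hasDerivWithinAt_nonneg (convex_Ico 0 T)
      (fun s hs => (h1 s hs).continuousWithinAt) (fun s hs => (h1 s (hsub hs)).mono hsub)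
      (fun s hs => h2 s (hsub hs)) ⟨le_rfl, ht.1.trans_lt ht.2⟩ ht ht.1
  have hPC : ∀ t ∈ Ico 0 T, C ≤ P t :=
    mono hP fun t ht => (by positivity : 0 ≤ k * F t ^ 2).trans (hQ t ht)
  have hFm : ∀ t ∈ Ico 0 T, F 0 ≤ F t := mono hF fun t ht => hP0.le.trans (hPC t ht)
  -- Multiply `F'' ≥ k (F - F 0)²` by `2F'` and integrate; `α = 2k/3` makes the cubic term match.
  -- Subtracting `F 0` is harmless since `0 ≤ F 0 ≤ F t`.
  have hen : ∀ t ∈ Ico 0 T, C ^ 2 ≤ P t ^ 2 - α * (F t - F 0) ^ 3 := by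
    have := mono (f := fun t => P t ^ 2 - α * (F t - F 0) ^ 3)
      (f' := fun t => 2 * P t * Q t - α * (3 * (F t - F 0) ^ 2 * P t))
      (fun t ht => by
        exact (((hP t ht).pow 2).sub ((((hF t ht).sub_const (F 0)).pow 3).const_mul α)).congr_deriv
          (by norm_num))
      (fun t ht => by
        have h1 := hQ t ht
        have h2 := hFm t ht
        have h3 := hP0.le.trans (hPC t ht)
        have h4 : k * (F t - F 0) ^ 2 ≤ Q t := by
          refine le_trans ?_ h1
          gcongr
          linarith
        have : 2 * P t * Q t - α * (3 * (F t - F 0) ^ 2 * P t) =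
            2 * (P t * (Q t - k * (F t - F 0) ^ 2)) := by rw [hα]; ring
        rw [this]
        have := mul_nonneg h3 (sub_nonneg.2 h4)
        positivity)
    simpa using this
  -- The absolute value makes the integrand continuous on the whole line.
  set q : ℝ → ℝ := fun y => 1 / Real.sqrt (|y| ^ 3 + 1) with hq
  have hqc : Continuous q := continuous_const.div₀ (by fun_prop) fun y => by positivity
  have hqd : ∀ z, HasDerivAt (fun z => ∫ y in (0 : ℝ)..z, q y) (q z) z := fun z =>
    intervalIntegral.integral_hasDerivAt_right (hqc.intervalIntegrable _ _)
      (hqc.stronglyMeasurableAtFilter _ _) hqc.continuousAt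
  have hqI : ∀ z, 0 ≤ z → ∫ y in (0 : ℝ)..z, q y ≤ I := fun z hz => by
    have e : I = ∫ y in Ioi (0 : ℝ), q y := setIntegral_congr_fun measurableSet_Ioi fun y hy => by
      simp only [hq, abs_of_pos (mem_Ioi.1 hy)]
    rw [e, intervalIntegral.integral_of_le hz]
    exact setIntegral_mono_set integrableOn_one_div_sqrt_cube_add_one
      (Eventually.of_forall fun y => by simp only [hq, Pi.zero_apply]; positivity)
      (Eventually.of_forall Ioc_subset_Ioi_self)
  have hmain : ∀ t ∈ Ico 0 T, t ≤ μ * I := by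
    intro t ht
    -- Separation of variables: the primitive of `q` at `y(t)` grows at rate at least `1/μ` while
    -- never exceeding `I`.
    have h1 := mono (f := fun t => (∫ y in (0 : ℝ)..((F t - F 0) / (C * μ)), q y) - t / μ)
      (f' := fun t => q ((F t - F 0) / (C * μ)) * (P t / (C * μ)) - 1 / μ)
      (fun t ht => (((hqd _).comp_hasDerivWithinAt t
        (((hF t ht).sub_const (F 0)).div_const (C * μ)))).sub
          ((hasDerivWithinAt_id t _).div_const μ))
      (fun t ht => by
        have hG : 0 ≤ F t - F 0 := sub_nonneg.2 (hFm t ht)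
        have hPt : 0 ≤ P t := hP0.le.trans (hPC t ht)
        have h2 : C * Real.sqrt (((F t - F 0) / (C * μ)) ^ 3 + 1) ≤ P t := by
          refine abs_le_of_sq_le_sq' ?_ hPt |>.2
          rw [mul_pow, Real.sq_sqrt (by positivity)]
          have h3 : ((F t - F 0) / (C * μ)) ^ 3 * C ^ 2 = α * (F t - F 0) ^ 3 := by
            rw [div_pow, mul_pow, div_mul_eq_mul_div, div_eq_iff (by positivity)]
            linear_combination (-(F t - F 0) ^ 3 * C ^ 2) * hμ3
          have := hen t ht
          nlinarith
        rw [hq]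
        dsimp only
        rw [abs_of_nonneg (div_nonneg hG (by positivity)), sub_nonneg, one_div_mul_eq_div,
          div_div, div_le_div_iff₀ hμ0 (by positivity)]
        have := mul_le_mul_of_nonneg_right h2 hμ0.le
        linarith) t ht
    simp only [sub_self, zero_div, intervalIntegral.integral_same] at h1
    have h2 := hqI ((F t - F 0) / (C * μ))
      (div_nonneg (sub_nonneg.2 (hFm t ht)) (by positivity))
    have h3 : t / μ ≤ I := by linarith
    rwa [div_le_iff₀ hμ0, mul_comm] at h3
  by_contra hcon
  push Not at hcon
  have hI0 : 0 ≤ I := integral_nonneg fun y => by positivity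
  obtain ⟨t, h1, h2⟩ := exists_between hcon
  exact absurd (hmain t ⟨(by positivity : 0 ≤ μ * I).trans h1.le, h2⟩) (not_le.2 h1)

/-! ### The weighted moment and its evolution. -/

/-- The functional `p ↦ ∫_a^b (x - a) p(x) dx` on `H¹(ℝ)`. -/
noncomputable def H1.momentL (a b : ℝ) : H1 →L[ℝ] ℝ :=
  LinearMap.mkContinuous
    { toFun := fun p => ∫ x in a..b, (x - a) * p.rep x
      map_add' := fun p q => by
        have hp := p.continuous_rep
        have hq := q.continuous_rep
        rw [← intervalIntegral.integral_add
          ((by fun_prop : Continuous fun x => (x - a) * p.rep x).intervalIntegrable _ _)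
          ((by fun_prop : Continuous fun x => (x - a) * q.rep x).intervalIntegrable _ _)]
        simp [H1.rep_add, mul_add]
      map_smul' := fun c p => by
        simp only [H1.rep_smul, Pi.smul_apply, smul_eq_mul, RingHom.id_apply]
        rw [← intervalIntegral.integral_const_mul]
        congr 1; funext x; ring }
    (|b - a| * 2 * |b - a|) fun p => by
      have h : ∀ x ∈ uIoc a b, ‖(x - a) * p.rep x‖ ≤ |b - a| * (2 * ‖p‖) := fun x hx => by
        rw [norm_mul]
        gcongr
        · exact abs_sub_left_of_mem_uIcc (uIoc_subset_uIcc hx)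
        · exact p.abs_rep_le x
      refine (intervalIntegral.norm_integral_le_of_norm_le_const h).trans_eq ?_
      ring

theorem H1.momentL_apply (a b : ℝ) (p : H1) :
    H1.momentL a b p = ∫ x in a..b, (x - a) * p.rep x := rfl

theorem H1.momentL_nonneg {a b : ℝ} (hab : a ≤ b) {p : H1} (hp : ∀ x, 0 ≤ p.rep x) :
    0 ≤ H1.momentL a b p :=
  intervalIntegral.integral_nonneg hab fun x hx => mul_nonneg (sub_nonneg.2 hx.1) (hp x)

theorem intervalIntegral_eq_integral_of_ae_eq_zero {a b : ℝ} (hab : a ≤ b) {f : ℝ → ℝ}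
    (hf : ∀ᵐ x, x ∉ Ioo a b → f x = 0) : ∫ x in a..b, f x = ∫ x, f x := by
  rw [intervalIntegral.integral_of_le hab]
  refine setIntegral_eq_integral_of_ae_compl_eq_zero ?_
  filter_upwards [hf] with x hx hx'
  exact hx fun h => hx' (Ioo_subset_Ioc_self h)

theorem H1.momentL_hilb {a b : ℝ} (hab : a ≤ b) {p : H1}
    (hp : ∀ᵐ x, x ∉ Ioo a b → p.rep x = 0) :
    H1.momentL a b (H1.mulL (H1.mulL p p) (H1.hilbMulL p p)) =
      (2 * Real.pi)⁻¹ * (∫ x, p.rep x * p.rep x) ^ 2 := by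
  have hc := p.continuous_rep
  have hf : ∀ᵐ x, x ∉ Ioo a b → p.rep x * p.rep x = 0 := by
    filter_upwards [hp] with x hx hx'
    rw [hx hx', zero_mul]
  have hψ : Integrable fun x => (x - a) * (p.rep x * p.rep x) := by
    have h1 : IntegrableOn (fun x => (x - a) * (p.rep x * p.rep x)) (Icc a b) :=
      (by fun_prop : Continuous fun x => (x - a) * (p.rep x * p.rep x)).continuousOn.integrableOn_Icc
    refine h1.integrable_of_ae_notMem_eq_zero ?_
    filter_upwards [hf] with x hx hx'
    rw [hx fun h => hx' (Ioo_subset_Icc_self h), mul_zero]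
  rw [H1.momentL_apply, ← (p.isW1Pair_mul p).integral_mul_hilb a hψ]
  simp only [H1.rep_mulL, H1.rep_hilbMulL, ← mul_assoc]
  refine intervalIntegral_eq_integral_of_ae_eq_zero hab ?_
  filter_upwards [hp] with x hx hx'
  rw [hx hx']
  ring

theorem H1.momentL_sq_le {a b : ℝ} (hab : a ≤ b) {p : H1}
    (hp : ∀ᵐ x, x ∉ Ioo a b → p.rep x = 0) :
    H1.momentL a b (H1.mulL p p) ^ 2 ≤ (b - a) ^ 2 * (∫ x, p.rep x * p.rep x) ^ 2 := by
  have hc := p.continuous_rep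
  have h0 : 0 ≤ H1.momentL a b (H1.mulL p p) :=
    H1.momentL_nonneg hab fun x => by rw [H1.rep_mulL]; exact mul_self_nonneg _
  rw [← mul_pow]
  refine pow_le_pow_left₀ h0 ?_ 2
  rw [← intervalIntegral_eq_integral_of_ae_eq_zero hab (by
    filter_upwards [hp] with x hx hx'
    rw [hx hx', zero_mul]), H1.momentL_apply, ← intervalIntegral.integral_const_mul]
  simp only [H1.rep_mulL]
  refine intervalIntegral.integral_mono_on hab (Continuous.intervalIntegrable (by fun_prop) _ _)
    (Continuous.intervalIntegrable (by fun_prop) _ _) fun x hx => ?_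
  exact mul_le_mul_of_nonneg_right (by linarith [hx.2]) (mul_self_nonneg _)

section Solution

variable {u₀ v₀ : H1} {T : ℝ} {w : ℝ → H1 × H1}

/-- At a fixed `x` the value of `u` solves the scalar linear equation `y' = 2 v y`, whose
coefficient is bounded by `4M` on `[0, t]`; Grönwall keeps zero data at zero. -/
theorem IsForwardSolution.rep_eq_zero (h : IsForwardSolution modelField (u₀, v₀) T w) {x : ℝ}
    (hx : u₀.rep x = 0) {t : ℝ} (ht : t ∈ Ico 0 T) : (w t).1.rep x = 0 := by
  have hsub : Icc 0 t ⊆ Ico 0 T := Icc_subset_Ico_right ht.2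
  have hc : ContinuousOn w (Icc 0 t) := h.continuousOn.mono hsub
  obtain ⟨M, hM⟩ := isCompact_Icc.exists_bound_of_continuousOn hc
  have hd : ∀ s ∈ Ico 0 t, HasDerivWithinAt (fun s => (w s).1.rep x)
      (((2 : ℝ) • H1.mulL (w s).1 (w s).2).rep x) (Ici s) s := fun s hs =>
    (H1.evalCLM x).hasFDerivAt.comp_hasDerivWithinAt s
      (h.hasDerivWithinAt_Ici ⟨hs.1, hs.2.trans ht.2⟩).fst
  refine eq_zero_of_abs_deriv_le_mul_abs_self_of_eq_zero_right (K := 4 * M)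
    ((H1.evalCLM x).continuous.comp_continuousOn
      (continuous_fst.comp_continuousOn hc)) hd ?_ ?_ t ⟨ht.1, le_rfl⟩
  · change (w 0).1.rep x = 0
    rw [h.initial, hx]
  · intro s hs
    change ‖_‖ ≤ 4 * M * ‖(w s).1.rep x‖
    rw [H1.rep_two_smul_mulL, norm_mul, norm_mul, Real.norm_ofNat]
    have h1 := (w s).2.abs_rep_le x
    have h2 := (norm_snd_le (w s)).trans (hM s (Ico_subset_Icc_self hs))
    have h3 : ‖(w s).2.rep x‖ ≤ 2 * M := h1.trans (by linarith)
    nlinarith [norm_nonneg ((w s).1.rep x)]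

theorem IsForwardSolution.le_of_support (h : IsForwardSolution modelField (u₀, v₀) T w) {a b : ℝ}
    (hab : a < b) (hsupp : ∀ᵐ x, x ∉ Ioo a b → u₀.rep x = 0)
    (hC : 0 < 4 * H1.momentL a b (H1.mulL (H1.mulL u₀ u₀) v₀)) :
    T ≤ (4 * (4 * H1.momentL a b (H1.mulL (H1.mulL u₀ u₀) v₀)) /
        (3 * Real.pi * (b - a) ^ 2)) ^ (-(1 / 3) : ℝ) *
      ∫ y in Ioi (0 : ℝ), 1 / Real.sqrt (y ^ 3 + 1) := by
  have hba : 0 < b - a := sub_pos.2 hab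
  have hpi := Real.pi_pos
  have hs : ∀ t ∈ Ico 0 T, ∀ᵐ x, x ∉ Ioo a b → (w t).1.rep x = 0 := fun t ht => by
    filter_upwards [hsupp] with x hx hx'
    exact h.rep_eq_zero (hx hx') ht
  have hu : ∀ t ∈ Ico 0 T, HasDerivWithinAt (fun t => (w t).1)
      ((2 : ℝ) • H1.mulL (w t).1 (w t).2) (Ico 0 T) t := fun t ht => (h.hasDerivWithinAt t ht).fst
  have hv : ∀ t ∈ Ico 0 T, HasDerivWithinAt (fun t => (w t).2)
      (H1.hilbMulL (w t).1 (w t).1) (Ico 0 T) t := fun t ht => (h.hasDerivWithinAt t ht).snd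
  have huu : ∀ t ∈ Ico 0 T, HasDerivWithinAt (fun t => H1.mulL (w t).1 (w t).1)
      ((4 : ℝ) • H1.mulL (H1.mulL (w t).1 (w t).1) (w t).2) (Ico 0 T) t := fun t ht => by
    convert! H1.mulL.hasDerivWithinAt_of_bilinear (hu t ht) (hu t ht) using 1
    refine H1.ext_rep (funext fun x => ?_)
    simp only [H1.rep_add, H1.rep_smul, Pi.add_apply, Pi.smul_apply, H1.rep_mulL, smul_eq_mul]
    ring
  have huuv : ∀ t ∈ Ico 0 T, HasDerivWithinAt (fun t => H1.mulL (H1.mulL (w t).1 (w t).1) (w t).2)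
      (H1.mulL (H1.mulL (w t).1 (w t).1) (H1.hilbMulL (w t).1 (w t).1) +
        H1.mulL ((4 : ℝ) • H1.mulL (H1.mulL (w t).1 (w t).1) (w t).2) (w t).2) (Ico 0 T) t :=
    fun t ht => H1.mulL.hasDerivWithinAt_of_bilinear (huu t ht) (hv t ht)
  -- `k` combines the `4` from `F''`, the `1/2π` of the moment identity and the `(b - a)²` lost in
  -- `H1.momentL_sq_le`.
  have key := lifespan_le_of_deriv_deriv_ge (T := T) (k := 2 / (Real.pi * (b - a) ^ 2))
    (F := fun t => H1.momentL a b (H1.mulL (w t).1 (w t).1))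
    (P := fun t => 4 * H1.momentL a b (H1.mulL (H1.mulL (w t).1 (w t).1) (w t).2))
    (Q := fun t => 4 * H1.momentL a b
      (H1.mulL (H1.mulL (w t).1 (w t).1) (H1.hilbMulL (w t).1 (w t).1) +
        H1.mulL ((4 : ℝ) • H1.mulL (H1.mulL (w t).1 (w t).1) (w t).2) (w t).2))
    (by positivity)
    (fun t ht => by
      have := (H1.momentL a b).hasFDerivAt.comp_hasDerivWithinAt t (huu t ht)
      rwa [map_smul, smul_eq_mul] at this)
    (fun t ht => ((H1.momentL a b).hasFDerivAt.comp_hasDerivWithinAt t (huuv t ht)).const_mul 4)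
    (fun t ht => by
      have h1 := H1.momentL_sq_le hab.le (hs t ht)
      have h2 := H1.momentL_hilb hab.le (hs t ht)
      -- The part of `F''` coming from the derivative of `u²`, pointwise `4u²v²` before weighting,
      -- is simply discarded.
      have h3 : 0 ≤ H1.momentL a b
          (H1.mulL ((4 : ℝ) • H1.mulL (H1.mulL (w t).1 (w t).1) (w t).2) (w t).2) :=
        H1.momentL_nonneg hab.le fun x => by
          simp only [H1.rep_smul, Pi.smul_apply, H1.rep_mulL, smul_eq_mul]
          nlinarith [sq_nonneg ((w t).1.rep x * (w t).2.rep x)]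
      rw [map_add, h2]
      have h4 := mul_le_mul_of_nonneg_left h1
        (by positivity : 0 ≤ 2 / (Real.pi * (b - a) ^ 2))
      have e : 2 / (Real.pi * (b - a) ^ 2) *
          ((b - a) ^ 2 * (∫ x, (w t).1.rep x * (w t).1.rep x) ^ 2) =
          4 * ((2 * Real.pi)⁻¹ * (∫ x, (w t).1.rep x * (w t).1.rep x) ^ 2) := by
        field_simp
        ring
      rw [e] at h4
      linarith)
    (H1.momentL_nonneg hab.le fun x => by rw [H1.rep_mulL]; exact mul_self_nonneg _)
    (by rw [h.initial]; exact hC)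
  refine key.trans_eq ?_
  rw [h.initial]
  congr 2
  field_simp
  ring

end Solution

/-! ### Conclusion. -/

theorem mainTheorem1 (a b : ℝ) (u₀ v₀ : H1)
    (hsupp : ∀ᵐ x : ℝ, x ∉ Ioo a b → u₀.fn x = 0)
    (C : ℝ) (hC : C = 4 * ∫ x in a..b, (x - a) * u₀.fn x ^ 2 * v₀.fn x)
    (hCpos : 0 < C) :
    ∃ T : ℝ, 0 < T ∧
      T ≤ (4 * C / (3 * Real.pi * (b - a) ^ 2)) ^ (-(1 / 3) : ℝ)
          * ∫ y in Ioi (0 : ℝ), 1 / Real.sqrt (y ^ 3 + 1) ∧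
      ∃ u v : ℝ → H1, IsH1Solution u₀ v₀ T u v ∧
        Tendsto (fun t => ‖u t‖ + ‖v t‖) (𝓝[<] T) atTop ∧
        ∀ (T' : ℝ) (u' v' : ℝ → H1), IsH1Solution u₀ v₀ T' u' v' →
          T' ≤ T ∧ ∀ t ∈ Ico 0 T', u' t = u t ∧ v' t = v t := by
  -- Otherwise the interval is empty, `u₀` vanishes almost everywhere and `C = 0`.
  have hab : a < b := by
    by_contra hcon
    have h0 : ∀ᵐ x : ℝ, u₀.fn x = 0 := by
      filter_upwards [hsupp] with x hx
      exact hx fun h => hcon (h.1.trans h.2)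
    have : ∫ x in a..b, (x - a) * u₀.fn x ^ 2 * v₀.fn x = 0 := by
      refine intervalIntegral.integral_zero_ae ?_
      filter_upwards [h0] with x hx _
      rw [hx]
      ring
    rw [hC, this, mul_zero] at hCpos
    exact lt_irrefl _ hCpos
  have hC' : C = 4 * H1.momentL a b (H1.mulL (H1.mulL u₀ u₀) v₀) := by
    rw [hC, H1.momentL_apply]
    congr 1
    refine intervalIntegral.integral_congr_ae ?_
    filter_upwards [u₀.rep_ae_eq, v₀.rep_ae_eq] with x h1 h2 _
    rw [H1.rep_mulL, H1.rep_mulL, h1, h2]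
    ring
  have hs : ∀ᵐ x, x ∉ Ioo a b → u₀.rep x = 0 := by
    filter_upwards [hsupp, u₀.rep_ae_eq] with x h1 h2 h3
    rw [h2, h1 h3]
  rw [hC'] at hCpos ⊢
  obtain ⟨T, w, hT, hw, hblow, hmax⟩ := lipschitzOnBalls_modelField.exists_maximal (u₀, v₀) _
    fun T w h => h.le_of_support hab hs hCpos
  refine ⟨T, hw.pos, hT, fun t => (w t).1, fun t => (w t).2, hw.isH1Solution, ?_, ?_⟩
  -- The product carries the maximum norm, which the sum of the norms dominates.
  · refine tendsto_atTop_mono (fun t => ?_) hblow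
    rw [Prod.norm_def]
    exact max_le_add_of_nonneg (norm_nonneg _) (norm_nonneg _)
  · intro T' u' v' h'
    obtain ⟨h1, h2⟩ := hmax T' _ h'.isForwardSolution
    exact ⟨h1, fun t ht => Prod.ext_iff.1 (h2 t ht)⟩
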